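/- **Proposition (Base change).** Let $k$ be a commutative ring containing $\mathbb{Q}$. A formal supermanifold is a $\mathbb{Z}$-graded $k$-module $V$, pointed by $0$. Let $S(V)$ be its graded symmetric algebra, with its shuffle comultiplication. A formal map $f:V\to W$ is a sequence of graded symmetric multilinear maps $f_n:V^{\odot n}\to W$, $n\ge 1$, of degree $0$, or, what is the same, a morphism of graded coalgebras $S(V)\to S(W)$ of degree $0$ with $1\mapsto 1$. For $I=(i_1,\dots,i_t)$ with all $i_j\ge 1$ and $|I|=i_1+\dots+i_t=r$ put $I!=i_1!\cdots i_t!$ and $$f_I(b_1,\dots,b_r)=\frac{1}{I!\,t!}\sum_{\sigma\in\Sigma_r}\epsilon(\sigma)\,f_{i_1}(b_{\sigma(1)},\dots,b_{\sigma(i_1)})\odot\cdots\odot f_{i_t}(b_{\sigma(r-i_t+1)},\dots,b_{\sigma(r)}),$$ where $\epsilon(\sigma)$ is the Koszul sign. A vectorfield of degree $1$ on $V$ is a coderivation $Q$ of $S(V)$ of degree $1$; its Taylor coefficients are $Q_n=\mathrm{pr}_V\circ Q|_{V^{\odot n}}$, $n\ge 0$. A formal DG manifold is a pair $(V,Q^V)$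 with $Q^V$ a vectorfield of degree $1$ such that $(Q^V)^2=0$; its morphisms are the formal maps whose coalgebra map commutes with the $Q$'s. It is local if $Q^V_0=0$. Let $(M,Q^M)$ be a formal DG manifold. A deformation of $M$ with local base $(B,Q^B)$ is a vectorfield $Q$ of degree $1$ on $B\times M$ with $Q_0=0$, such that $Q|_{\{0\}\times M}=0$, $\tilde Q:=Q^M+Q^B+Q$ satisfies $\tilde Q^2=0$, and the projection $(B\times M,\tilde Q)\to (B,Q^B)$ is a morphism of formal DG manifolds. A morphism of deformations $(B,Q^B,Q)\to(B',Q^{B'},Q')$ of $M$ is a pair $(F,f)$ of morphisms of formal DG manifolds $F:(B\times M,\tilde Q)\to(B'\times M,\tilde Q')$ and $f:B\to B'$ such that $F$ is compatible with the inclusions of $M$ and the square formed by $F$, $f$ and the two projections is cartesian in the category of formal DG manifolds. Let $(B',Q^{B'},Q')$ be a deformation of $(M,Q^M)$ and $f:B\to B'$ a morphism of formal DG manifolds with $B=(B,Q^B)$ local. Then there is exactly one vectorfield $Q$ of degree $1$ on $B\times M$ with $$Q_{r+s}(b_1,\dots,b_r,m_1,\dots,m_s)=\sum_{t=1}^{r}\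 \sum_{I\in\mathbb{N}_{\ge1}^t,\ |I|=r}Q'_{s+t}\bigl(f_I(b_1,\dots,b_r),m_1,\dots,m_s\bigr)$$ for $r\ge 1$, $s\ge 0$, $b_i\in B$, $m_j\in M$, and $Q_s(m_1,\dots,m_s)=0$ for $s\ge 0$. The triple $(B,Q^B,Q)$ is a deformation of $(M,Q^M)$, and $(f\times\mathrm{Id},f)$ is a morphism of deformations $(B,Q^B,Q)\to(B',Q^{B'},Q')$; in particular the square formed by $f\times\mathrm{Id}$, $f$ and the two projections is cartesian in the category of formal DG manifolds. -/

import Mathlib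

open CategoryTheory
open scoped TensorProduct DirectSum

universe u v

namespace FormalDG

/-! ## Graded modules and the graded symmetric coalgebra -/

/-- A formal supermanifold over `k`: a `ℤ`-graded `k`-module, pointed by its zero element. -/
structure FormalSupermanifold (k : Type u) [CommRing k] : Type (max u (v + 1)) where
  obj : ℤ → Type v
  [addCommGroup : ∀ i, AddCommGroup (obj i)]
  [module : ∀ i, Module k (obj i)]

attribute [instance] FormalSupermanifold.addCommGroup FormalSupermanifold.module

section Basic

variable {k : Type u} [CommRing k]

/-- The underlying module `⨁ Vⁱ` of a graded module. -/
abbrev FormalSupermanifold.Total (V : FormalSupermanifold.{u, v} k) : Type v :=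
  ⨁ i, V.obj i

/-- The homogeneous element `a ∈ Vⁱ` as an element of `⨁ Vⁱ`. -/
noncomputable def FormalSupermanifold.hom (V : FormalSupermanifold.{u, v} k) (i : ℤ) :
    V.obj i →ₗ[k] V.Total :=
  DirectSum.lof k ℤ V.obj i

/-- The relations `a ⊗ b = (-1)^{ij} b ⊗ a` for `a ∈ Vⁱ`, `b ∈ Vʲ`. -/
inductive SymRel (V : FormalSupermanifold.{u, v} k) :
    TensorAlgebra k V.Total → TensorAlgebra k V.Total → Prop
  | swap (i j : ℤ) (a : V.obj i) (b : V.obj j) :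
      SymRel V
        (TensorAlgebra.ι k (V.hom i a) * TensorAlgebra.ι k (V.hom j b))
        ((-1 : ℤˣ) ^ (i * j) •
          (TensorAlgebra.ι k (V.hom j b) * TensorAlgebra.ι k (V.hom i a)))

/-- The graded symmetric algebra `S(V)`. -/
def Sym (V : FormalSupermanifold.{u, v} k) : Type (max u v) := RingQuot (SymRel V)

noncomputable instance (V : FormalSupermanifold.{u, v} k) : Ring (Sym V) :=
  inferInstanceAs (Ring (RingQuot (SymRel V)))

noncomputable instance (V : FormalSupermanifold.{u, v} k) : Algebra k (Sym V) :=
  inferInstanceAs (Algebra k (RingQuot (SymRel V)))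

namespace Sym

variable (V : FormalSupermanifold.{u, v} k)

/-- The inclusion `V → S(V)`. -/
noncomputable def ι : V.Total →ₗ[k] Sym V :=
  (RingQuot.mkAlgHom k (SymRel V)).toLinearMap ∘ₗ TensorAlgebra.ι k

/-- The homogeneous generator of `S(V)` given by `a ∈ Vⁱ`. -/
noncomputable def gen (i : ℤ) : V.obj i →ₗ[k] Sym V := ι V ∘ₗ V.hom i

theorem gen_mul_gen (i j : ℤ) (a : V.obj i) (b : V.obj j) :
    gen V i a * gen V j b = (-1 : ℤˣ) ^ (i * j) • (gen V j b * gen V i a) := by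
  have h := RingQuot.mkAlgHom_rel k (SymRel.swap i j a b)
  rw [Units.smul_def, map_zsmul, map_mul, map_mul, ← Units.smul_def] at h
  exact h

variable {V}

/-- The universal property of `S(V)` as an algebra. -/
noncomputable def lift {A : Type*} [Ring A] [Algebra k A] (f : V.Total →ₗ[k] A)
    (hf : ∀ (i j : ℤ) (a : V.obj i) (b : V.obj j),
      f (V.hom i a) * f (V.hom j b) =
        (-1 : ℤˣ) ^ (i * j) • (f (V.hom j b) * f (V.hom i a))) :
    Sym V →ₐ[k] A :=
  RingQuot.liftAlgHom k ⟨TensorAlgebra.lift k f, by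
    rintro _ _ ⟨i, j, a, b⟩
    rw [Units.smul_def, map_zsmul, map_mul, map_mul, ← Units.smul_def]
    simpa using hf i j a b⟩

@[simp]
theorem lift_ι {A : Type*} [Ring A] [Algebra k A] (f : V.Total →ₗ[k] A) (hf) (x : V.Total) :
    lift f hf (ι V x) = f x := by
  have h := RingQuot.liftAlgHom_mkAlgHom_apply k (TensorAlgebra.lift k f)
    (s := SymRel V) (by
      rintro _ _ ⟨i, j, a, b⟩
      rw [Units.smul_def, map_zsmul, map_mul, map_mul, ← Units.smul_def]
      simpa using hf i j a b) (TensorAlgebra.ι k x)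
  rw [TensorAlgebra.lift_ι_apply] at h
  exact h

@[simp]
theorem lift_gen {A : Type*} [Ring A] [Algebra k A] (f : V.Total →ₗ[k] A) (hf) (i : ℤ)
    (x : V.obj i) : lift f hf (gen V i x) = f (V.hom i x) :=
  lift_ι f hf _

theorem algHom_ext {A : Type*} [Ring A] [Algebra k A] {f g : Sym V →ₐ[k] A}
    (h : ∀ i (x : V.obj i), f (gen V i x) = g (gen V i x)) : f = g := by
  apply RingQuot.ringQuot_ext' k
  apply TensorAlgebra.hom_ext
  apply DirectSum.linearMap_ext
  intro i
  ext x
  exact h i x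

variable (V)

/-- The part of linear degree `d` of `S(V)`: the span of the products `a₁ ⊙ ⋯ ⊙ aₙ` of
homogeneous elements with `|a₁| + ⋯ + |aₙ| = d`. -/
noncomputable def degree (d : ℤ) : Submodule k (Sym V) :=
  Submodule.span k {x | ∃ l : List (Σ i, V.obj i),
    (l.map Sigma.fst).sum = d ∧ (l.map fun a => gen V a.1 a.2).prod = x}

theorem gen_mem (i : ℤ) (a : V.obj i) : gen V i a ∈ degree V i :=
  Submodule.subset_span ⟨[⟨i, a⟩], by simp, by simp⟩

noncomputable instance : SetLike.GradedMonoid (degree V) where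
  one_mem := Submodule.subset_span ⟨[], rfl, rfl⟩
  mul_mem := by
    intro i j x y hx hy
    induction hx using Submodule.span_induction with
    | zero => simp
    | add _ _ _ _ h h' => rw [add_mul]; exact add_mem h h'
    | smul r _ _ h => rw [smul_mul_assoc]; exact Submodule.smul_mem _ r h
    | mem x hx =>
      induction hy using Submodule.span_induction with
      | zero => simp
      | add _ _ _ _ h h' => rw [mul_add]; exact add_mem h h'
      | smul r _ _ h => rw [mul_smul_comm]; exact Submodule.smul_mem _ r h
      | mem y hy =>
        obtain ⟨l, rfl, rfl⟩ := hx
        obtain ⟨l', rfl, rfl⟩ := hy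
        exact Submodule.subset_span ⟨l ++ l', by simp, by simp⟩

/-- The inclusion `V → S(V)`, as a map into the sum of the parts of fixed linear degree. -/
noncomputable def degreeι : V.Total →ₗ[k] ⨁ d, degree V d :=
  DirectSum.toModule k ℤ _ fun i =>
    DirectSum.lof k ℤ (fun d => degree V d) i ∘ₗ (gen V i).codRestrict _ (gen_mem V i)

theorem degreeι_hom (i : ℤ) (a : V.obj i) :
    degreeι V (V.hom i a) =
      DirectSum.of (fun d => degree V d) i ⟨gen V i a, gen_mem V i a⟩ := by
  rw [degreeι, FormalSupermanifold.hom, DirectSum.toModule_lof]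
  rfl

/-- The decomposition of `S(V)` into its parts of fixed linear degree. -/
noncomputable def decompose : Sym V →ₐ[k] ⨁ d, degree V d :=
  lift (A := ⨁ d, degree V d) (degreeι V) (by
    intro i j a b
    have h := gen_mul_gen V i j a b
    rw [degreeι_hom, degreeι_hom, DirectSum.of_mul_of, DirectSum.of_mul_of]
    rcases Int.units_eq_one_or ((-1 : ℤˣ) ^ (i * j)) with hs | hs
    · rw [hs, one_smul] at h ⊢
      exact DirectSum.of_eq_of_gradedMonoid_eq (Sigma.subtype_ext (add_comm _ _) h)
    · have hneg : ∀ {A : Type (max u v)} [Ring A] (x : A), (-1 : ℤˣ) • x = -x := by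
        intro A _ x
        rw [Units.neg_smul, one_smul]
      rw [hs, hneg] at h
      rw [hs]
      refine Eq.trans ?_ (hneg (A := ⨁ d, degree V d) _).symm
      rw [← map_neg]
      exact DirectSum.of_eq_of_gradedMonoid_eq (Sigma.subtype_ext (add_comm _ _) h))

theorem decompose_gen (i : ℤ) (a : V.obj i) :
    decompose V (gen V i a) = DirectSum.of (fun d => degree V d) i ⟨gen V i a, gen_mem V i a⟩ := by
  rw [decompose, lift_gen, degreeι_hom]

/-- The linear grading makes `S(V)` a graded algebra. -/
noncomputable instance : GradedAlgebra (degree V) :=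
  GradedAlgebra.ofAlgHom _ (decompose V)
    (by
      apply algHom_ext
      intro i a
      simp [decompose_gen])
    (by
      rintro d ⟨x, hx⟩
      simp only
      induction hx using Submodule.span_induction with
      | zero => simp only [map_zero]; exact (map_zero (DirectSum.of _ d)).symm
      | add x y hx hy h h' =>
        rw [map_add, h, h', ← map_add]; rfl
      | smul r x hx h =>
        rw [map_smul, h, ← DirectSum.lof_eq_of k, ← map_smul]; rfl
      | mem x hx =>
        obtain ⟨l, rfl, rfl⟩ := hx
        induction l with
        | nil => simp only [List.map_nil, List.prod_nil, map_one]; rfl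
        | cons a l ih =>
          simp only [List.map_cons, List.prod_cons, map_mul, decompose_gen]
          rw [ih, DirectSum.of_mul_of]
          exact DirectSum.of_eq_of_gradedMonoid_eq rfl)

/-- The comultiplication of `S(V)`, as the morphism of graded algebras
`S(V) → S(V) ⊗ S(V)` with `v ↦ v ⊗ 1 + 1 ⊗ v` for `v ∈ V`. The product on the right is the
one of the Koszul sign rule, `(a ⊗ b)(a' ⊗ b') = (-1)^{|b||a'|} aa' ⊗ bb'`, and so
`a₁ ⊙ ⋯ ⊙ aₙ` is mapped to the sum over all shuffles
`∑ ε(σ) a_{σ(1)} ⊙ ⋯ ⊙ a_{σ(j)} ⊗ a_{σ(j+1)} ⊙ ⋯ ⊙ a_{σ(n)}`. -/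
noncomputable def comulAlg : Sym V →ₐ[k] (degree V) ᵍ⊗[k] (degree V) :=
  lift
    ((GradedTensorProduct.includeLeft (degree V) (degree V)).toLinearMap ∘ₗ ι V +
      (GradedTensorProduct.includeRight (degree V) (degree V)).toLinearMap ∘ₗ ι V) (by
      intro i j a b
      have key : ∀ (i j : ℤ) (a : V.obj i) (b : V.obj j),
          GradedTensorProduct.includeRight (degree V) (degree V) (gen V i a) *
            GradedTensorProduct.includeLeft (degree V) (degree V) (gen V j b) =
          (-1 : ℤˣ) ^ (i * j) •
            (GradedTensorProduct.includeLeft (degree V) (degree V) (gen V j b) *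
              GradedTensorProduct.includeRight (degree V) (degree V) (gen V i a)) := by
        intro i j a b
        simp only [GradedTensorProduct.includeLeft_apply, GradedTensorProduct.includeRight_apply]
        rw [GradedTensorProduct.tmul_one_mul_one_tmul]
        have h := GradedTensorProduct.tmul_coe_mul_coe_tmul (degree V) (degree V) (1 : Sym V)
          ⟨gen V i a, gen_mem V i a⟩ ⟨gen V j b, gen_mem V j b⟩ (1 : Sym V)
        rw [one_mul, mul_one] at h
        exact h
      have hsq : (-1 : ℤˣ) ^ (i * j) * (-1 : ℤˣ) ^ (i * j) = 1 := Int.units_mul_self _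
      have hs : ∀ f : Sym V →ₐ[k] (degree V) ᵍ⊗[k] (degree V),
          f (gen V i a) * f (gen V j b) =
            (-1 : ℤˣ) ^ (i * j) • (f (gen V j b) * f (gen V i a)) := by
        intro f
        rw [← map_mul, ← map_mul, gen_mul_gen, Units.smul_def, map_zsmul, ← Units.smul_def]
      have h1 := key i j a b
      have h2 := key j i b a
      rw [mul_comm j i] at h2
      have h3 := hs (GradedTensorProduct.includeLeft (degree V) (degree V))
      have h4 := hs (GradedTensorProduct.includeRight (degree V) (degree V))
      change (GradedTensorProduct.includeLeft (degree V) (degree V) (gen V i a) +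
          GradedTensorProduct.includeRight (degree V) (degree V) (gen V i a)) *
        (GradedTensorProduct.includeLeft (degree V) (degree V) (gen V j b) +
          GradedTensorProduct.includeRight (degree V) (degree V) (gen V j b)) =
        (-1 : ℤˣ) ^ (i * j) •
        ((GradedTensorProduct.includeLeft (degree V) (degree V) (gen V j b) +
          GradedTensorProduct.includeRight (degree V) (degree V) (gen V j b)) *
        (GradedTensorProduct.includeLeft (degree V) (degree V) (gen V i a) +
          GradedTensorProduct.includeRight (degree V) (degree V) (gen V i a)))
      rw [add_mul, mul_add, mul_add, add_mul, mul_add, mul_add, h1, h2, h3, h4]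
      simp only [smul_add, smul_smul, hsq, one_smul]
      abel)

/-- The comultiplication `Δ : S(V) → S(V) ⊗ S(V)`. -/
noncomputable def comul : Sym V →ₗ[k] Sym V ⊗[k] Sym V :=
  (GradedTensorProduct.of k (degree V) (degree V)).symm.toLinearMap ∘ₗ (comulAlg V).toLinearMap

/-- The counit `S(V) → k`, the projection to the part of polynomial degree `0`. -/
noncomputable def counit : Sym V →ₐ[k] k := lift 0 (by simp)

/-- Auxiliary: `v ∈ V` acts on `k × V` by `(c, w) ↦ (0, c v)`. -/
noncomputable def projAux : V.Total →ₗ[k] Module.End k (k × V.Total) where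
  toFun v := LinearMap.inr k k V.Total ∘ₗ (LinearMap.fst k k V.Total).smulRight v
  map_add' v w := by ext <;> simp
  map_smul' c v := by ext <;> simp

/-- The projection `pr_V : S(V) → V` to the part of polynomial degree `1`. It is realised
through the action of `S(V)` on `k × V` in which `v ∈ V` maps `(c, w)` to `(0, c v)`. -/
noncomputable def proj : Sym V →ₗ[k] V.Total :=
  LinearMap.snd k k V.Total ∘ₗ LinearMap.applyₗ ((1, 0) : k × V.Total) ∘ₗ
    (lift (projAux V) (by
      intro i j a b
      have h : ∀ v w, projAux V v * projAux V w = 0 := by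
        intro v w
        apply LinearMap.ext
        intro x
        simp [projAux]
      rw [h, h, smul_zero])).toLinearMap

variable {V} {W X : FormalSupermanifold.{u, v} k}

/-- The algebra morphism `S(φ) : S(V) → S(W)` of a linear map `φ : V → W` of degree `0`. -/
noncomputable def map (φ : ∀ i, V.obj i →ₗ[k] W.obj i) : Sym V →ₐ[k] Sym W :=
  lift (ι W ∘ₗ DirectSum.lmap φ) (by
    intro i j a b
    have h : ∀ (i : ℤ) (a : V.obj i),
        (ι W ∘ₗ DirectSum.lmap φ) (V.hom i a) = gen W i (φ i a) := by
      intro i a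
      rw [gen, LinearMap.comp_apply, LinearMap.comp_apply, FormalSupermanifold.hom,
        DirectSum.lmap_lof]
      rfl
    rw [h, h, gen_mul_gen])

@[simp]
theorem map_gen (φ : ∀ i, V.obj i →ₗ[k] W.obj i) (i : ℤ) (a : V.obj i) :
    map φ (gen V i a) = gen W i (φ i a) := by
  rw [map, lift_gen, LinearMap.comp_apply, FormalSupermanifold.hom, DirectSum.lmap_lof]
  rfl

theorem map_mem (φ : ∀ i, V.obj i →ₗ[k] W.obj i) (d : ℤ) (x : Sym V) (hx : x ∈ degree V d) :
    map φ x ∈ degree W d := by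
  induction hx using Submodule.span_induction with
  | zero => simp
  | add _ _ _ _ h h' => rw [map_add]; exact add_mem h h'
  | smul r _ _ h => rw [map_smul]; exact Submodule.smul_mem _ r h
  | mem x hx =>
    obtain ⟨l, rfl, rfl⟩ := hx
    refine Submodule.subset_span ⟨l.map fun a => ⟨a.1, φ a.1 a.2⟩, ?_, ?_⟩
    · rw [List.map_map]; rfl
    · rw [map_list_prod, List.map_map, List.map_map]
      congr 1
      apply List.map_congr_left
      intro a _
      simp

theorem counit_map (φ : ∀ i, V.obj i →ₗ[k] W.obj i) (x : Sym V) :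
    counit W (map φ x) = counit V x := by
  have h : (counit W).comp (map φ) = counit V := by
    apply algHom_ext
    intro i a
    simp [counit]
  exact DFunLike.congr_fun h x

theorem comulAlg_gen (i : ℤ) (a : V.obj i) :
    comulAlg V (gen V i a) =
      GradedTensorProduct.includeLeft (degree V) (degree V) (gen V i a) +
      GradedTensorProduct.includeRight (degree V) (degree V) (gen V i a) := by
  rw [comulAlg, lift_gen]
  rfl

theorem comul_map (φ : ∀ i, V.obj i →ₗ[k] W.obj i) (x : Sym V) :
    comul W (map φ x) =
      TensorProduct.map (map φ).toLinearMap (map φ).toLinearMap (comul V x) := by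
  have hanti : ∀ ⦃i j : ℤ⦄ (a : degree V i) (b : degree V j),
      ((GradedTensorProduct.includeLeft (degree W) (degree W)).comp (map φ)) a *
        ((GradedTensorProduct.includeRight (degree W) (degree W)).comp (map φ)) b =
      (-1 : ℤˣ) ^ (j * i) •
        (((GradedTensorProduct.includeRight (degree W) (degree W)).comp (map φ)) b *
          ((GradedTensorProduct.includeLeft (degree W) (degree W)).comp (map φ)) a) := by
    intro i j a b
    simp only [AlgHom.comp_apply, GradedTensorProduct.includeLeft_apply,
      GradedTensorProduct.includeRight_apply]
    rw [GradedTensorProduct.tmul_one_mul_one_tmul]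
    have h := GradedTensorProduct.tmul_coe_mul_coe_tmul (degree W) (degree W) (1 : Sym W)
      ⟨map φ b, map_mem φ j b b.2⟩ ⟨map φ a, map_mem φ i a a.2⟩ (1 : Sym W)
    rw [one_mul, mul_one] at h
    rw [h, smul_smul, Int.units_mul_self, one_smul]
  have h : (comulAlg W).comp (map φ) =
      (GradedTensorProduct.lift (degree V) (degree V) _ _ hanti).comp (comulAlg V) := by
    apply algHom_ext
    intro i a
    rw [AlgHom.comp_apply, AlgHom.comp_apply, map_gen, comulAlg_gen, comulAlg_gen, map_add]
    simp only [GradedTensorProduct.includeLeft_apply, GradedTensorProduct.includeRight_apply,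
      GradedTensorProduct.lift_tmul, AlgHom.comp_apply, map_gen, _root_.map_one]
    rw [← GradedTensorProduct.includeLeft_apply, ← GradedTensorProduct.includeRight_apply]
    simp
  have h2 : ∀ y : Sym V ⊗[k] Sym V,
      GradedTensorProduct.lift (degree V) (degree V) _ _ hanti
        (GradedTensorProduct.of k (degree V) (degree V) y) =
      GradedTensorProduct.of k (degree W) (degree W)
        (TensorProduct.map (map φ).toLinearMap (map φ).toLinearMap y) := by
    intro y
    induction y using TensorProduct.induction_on with
    | zero => simp
    | add x y hx hy => rw [map_add, map_add, hx, hy, map_add, map_add]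
    | tmul x y =>
      exact GradedTensorProduct.tmul_one_mul_one_tmul (degree W) (degree W) (map φ x) (map φ y)
  have h3 := DFunLike.congr_fun h x
  exact h3.trans (h2 (comul V x))

/-- The sign operator `x ↦ (-1)^{|x|} x` on `S(V)`. -/
noncomputable def sign (V : FormalSupermanifold.{u, v} k) : Sym V →ₐ[k] Sym V :=
  map fun i => (((-1 : ℤˣ) ^ i : ℤˣ) : ℤ) • LinearMap.id

end Sym

/-! ## Formal maps and vectorfields -/

/-- A morphism of formal supermanifolds `V → W`, as the morphism of coalgebras
`S(V) → S(W)` of degree `0` with `1 ↦ 1` which it induces. -/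
@[ext]
structure FormalMap (V W : FormalSupermanifold.{u, v} k) where
  toLin : Sym V →ₗ[k] Sym W
  map_one : toLin 1 = 1
  map_degree : ∀ d, ∀ x ∈ Sym.degree V d, toLin x ∈ Sym.degree W d
  counit_comp : ∀ x, Sym.counit W (toLin x) = Sym.counit V x
  comul_comp : ∀ x, Sym.comul W (toLin x) = TensorProduct.map toLin toLin (Sym.comul V x)

/-- The category of formal supermanifolds. -/
noncomputable instance : Category (FormalSupermanifold.{u, v} k) where
  Hom V W := FormalMap V W
  id V :=
    { toLin := LinearMap.id
      map_one := rfl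
      map_degree := fun _ _ h => h
      counit_comp := fun _ => rfl
      comul_comp := fun x => by rw [TensorProduct.map_id]; rfl }
  comp F G :=
    { toLin := G.toLin ∘ₗ F.toLin
      map_one := by rw [LinearMap.comp_apply, F.map_one, G.map_one]
      map_degree := fun d x h => G.map_degree d _ (F.map_degree d x h)
      counit_comp := fun x => by rw [LinearMap.comp_apply, G.counit_comp, F.counit_comp]
      comul_comp := fun x => by
        rw [LinearMap.comp_apply, G.comul_comp, F.comul_comp, TensorProduct.map_comp]; rfl }

/-- The formal map with Taylor coefficients `φ, 0, 0, …` of a linear map `φ` of degree `0`. -/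
noncomputable def strict {V W : FormalSupermanifold.{u, v} k}
    (φ : ∀ i, V.obj i →ₗ[k] W.obj i) : V ⟶ W :=
  { toLin := (Sym.map φ).toLinearMap
    map_one := map_one (Sym.map φ)
    map_degree := Sym.map_mem φ
    counit_comp := Sym.counit_map φ
    comul_comp := Sym.comul_map φ : FormalMap V W }

/-- The Taylor coefficients of a formal map: `f_n(w₁, …, w_n)` is the value of `coeff f`
at `w₁ ⊙ ⋯ ⊙ w_n`. -/
noncomputable def coeff {V W : FormalSupermanifold.{u, v} k} (f : V ⟶ W) :
    Sym V →ₗ[k] W.Total :=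
  Sym.proj W ∘ₗ FormalMap.toLin f

/-- A vectorfield of degree `1` on `V`: a coderivation of degree `1` of `S(V)`, that is
`Δ Q = (Q ⊗ 1 + 1 ⊗ Q) Δ`, where `(1 ⊗ Q)(a ⊗ b) = (-1)^{|a|} a ⊗ Q(b)`. -/
structure IsVectorField (V : FormalSupermanifold.{u, v} k) (Q : Sym V →ₗ[k] Sym V) : Prop where
  map_degree : ∀ d, ∀ x ∈ Sym.degree V d, Q x ∈ Sym.degree V (d + 1)
  comul_comp : ∀ x, Sym.comul V (Q x) =
    TensorProduct.map Q LinearMap.id (Sym.comul V x) +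
      TensorProduct.map (Sym.sign V).toLinearMap Q (Sym.comul V x)

/-- A DG structure on `V`: a vectorfield `Q` of degree `1` with `Q² = 0`. -/
structure IsDGStructure (V : FormalSupermanifold.{u, v} k) (Q : Sym V →ₗ[k] Sym V) : Prop
    extends IsVectorField V Q where
  sq_zero : ∀ x, Q (Q x) = 0

/-- The coderivation with Taylor coefficients `q`. Explicitly, `w₁ ⊙ ⋯ ⊙ w_n` is mapped to
`∑ ε(σ) q_l(w_{σ(1)}, …, w_{σ(l)}) ⊙ w_{σ(l+1)} ⊙ ⋯ ⊙ w_{σ(n)}`, where the sum is over all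
`0 ≤ l ≤ n` and all `(l, n - l)`-shuffles `σ`. -/
noncomputable def ofCoeff {V : FormalSupermanifold.{u, v} k} (q : Sym V →ₗ[k] V.Total) :
    Sym V →ₗ[k] Sym V :=
  LinearMap.mul' k (Sym V) ∘ₗ TensorProduct.map (Sym.ι V ∘ₗ q) LinearMap.id ∘ₗ Sym.comul V

/-! ## Products -/

/-- The product of two formal supermanifolds. -/
def FormalSupermanifold.prod (A B : FormalSupermanifold.{u, v} k) :
    FormalSupermanifold.{u, v} k where
  obj i := A.obj i × B.obj i

section Prod

variable (A B : FormalSupermanifold.{u, v} k)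

/-- The projection `A × B → A`. -/
noncomputable def fst : A.prod B ⟶ A := strict fun i => LinearMap.fst k (A.obj i) (B.obj i)

/-- The projection `A × B → B`. -/
noncomputable def snd : A.prod B ⟶ B := strict fun i => LinearMap.snd k (A.obj i) (B.obj i)

/-- The inclusion `A = A × {0} → A × B`. -/
noncomputable def inl : A ⟶ A.prod B := strict fun i => LinearMap.inl k (A.obj i) (B.obj i)

/-- The inclusion `B = {0} × B → A × B`. -/
noncomputable def inr : B ⟶ A.prod B := strict fun i => LinearMap.inr k (A.obj i) (B.obj i)

variable {A B}

/-- A vectorfield on `A`, considered as a vectorfield on `A × B`: its Taylor coefficients are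
`((a₁, b₁), …, (a_n, b_n)) ↦ (Q_n(a₁, …, a_n), 0)`. -/
noncomputable def extendLeft (Q : Sym A →ₗ[k] Sym A) :
    Sym (A.prod B) →ₗ[k] Sym (A.prod B) :=
  ofCoeff (DirectSum.lmap (fun i => LinearMap.inl k (A.obj i) (B.obj i)) ∘ₗ
    Sym.proj A ∘ₗ Q ∘ₗ FormalMap.toLin (fst A B))

/-- A vectorfield on `B`, considered as a vectorfield on `A × B`: its Taylor coefficients are
`((a₁, b₁), …, (a_n, b_n)) ↦ (0, Q_n(b₁, …, b_n))`. -/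
noncomputable def extendRight (Q : Sym B →ₗ[k] Sym B) :
    Sym (A.prod B) →ₗ[k] Sym (A.prod B) :=
  ofCoeff (DirectSum.lmap (fun i => LinearMap.inr k (A.obj i) (B.obj i)) ∘ₗ
    Sym.proj B ∘ₗ Q ∘ₗ FormalMap.toLin (snd A B))

end Prod

/-! ## Formal DG manifolds -/

variable (k) in
/-- A formal DG manifold. -/
structure DGManifold : Type (max u (v + 1)) where
  carrier : FormalSupermanifold.{u, v} k
  Q : Sym carrier →ₗ[k] Sym carrier
  isDG : IsDGStructure carrier Q

/-- Morphisms of formal DG manifolds: `Q`-equivariant formal maps. -/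
@[ext]
structure DGMap (M N : DGManifold.{u, v} k) where
  toMap : M.carrier ⟶ N.carrier
  equivariant : ∀ x, FormalMap.toLin toMap (M.Q x) = N.Q (FormalMap.toLin toMap x)

/-- The category of formal DG manifolds. -/
noncomputable instance : Category (DGManifold.{u, v} k) where
  Hom M N := DGMap M N
  id M := ⟨𝟙 M.carrier, fun _ => rfl⟩
  comp f g := ⟨f.toMap ≫ g.toMap, fun x =>
    (congrArg (FormalMap.toLin g.toMap) (f.equivariant x)).trans (g.equivariant _)⟩

/-- The formal map underlying a morphism of formal DG manifolds. -/
def underlying {M N : DGManifold.{u, v} k} (f : M ⟶ N) : M.carrier ⟶ N.carrier :=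
  DGMap.toMap f

/-- A formal DG manifold is local if `Q₀ = Q(1)` vanishes. -/
def DGManifold.IsLocal (M : DGManifold.{u, v} k) : Prop := M.Q 1 = 0

/-! ## Deformations -/

/-- The vectorfield `Q^M + Q^B + Q` on `B × M`. -/
noncomputable def totalField (M B : DGManifold.{u, v} k)
    (Q : Sym (B.carrier.prod M.carrier) →ₗ[k] Sym (B.carrier.prod M.carrier)) :
    Sym (B.carrier.prod M.carrier) →ₗ[k] Sym (B.carrier.prod M.carrier) :=
  extendRight M.Q + extendLeft B.Q + Q

/-- A deformation of `M` with base `B`. -/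
structure Deformation (M B : DGManifold.{u, v} k) where
  isLocal : B.IsLocal
  /-- The perturbation. -/
  Q : Sym (B.carrier.prod M.carrier) →ₗ[k] Sym (B.carrier.prod M.carrier)
  isVectorField : IsVectorField (B.carrier.prod M.carrier) Q
  Q_zero : Q 1 = 0
  /-- `Q` vanishes on `{0} × M`. -/
  restrict : ∀ x, Q (FormalMap.toLin (inr B.carrier M.carrier) x) = 0
  isDG : IsDGStructure (B.carrier.prod M.carrier) (totalField M B Q)
  /-- The projection `B × M → B` is equivariant. -/
  proj_equivariant : ∀ x, FormalMap.toLin (fst B.carrier M.carrier) (totalField M B Q x) =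
    B.Q (FormalMap.toLin (fst B.carrier M.carrier) x)

namespace Deformation

variable {M B B' : DGManifold.{u, v} k}

/-- The total space `(B × M, Q^M + Q^B + Q)`. -/
noncomputable def total (D : Deformation M B) : DGManifold.{u, v} k where
  carrier := B.carrier.prod M.carrier
  Q := totalField M B D.Q
  isDG := D.isDG

/-- The projection of the total space to the base. -/
noncomputable def proj (D : Deformation M B) : D.total ⟶ B :=
  (⟨fst B.carrier M.carrier, D.proj_equivariant⟩ : DGMap D.total B)

/-- The inclusion of `M` into the total space. -/
noncomputable def incl (D : Deformation M B) : M.carrier ⟶ D.total.carrier :=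
  inr B.carrier M.carrier

/-- The pair `(F, f)` is a morphism of deformations of `M`. -/
structure IsMorphism (D : Deformation M B) (D' : Deformation M B')
    (F : D.total ⟶ D'.total) (f : B ⟶ B') : Prop where
  /-- The square formed by `F`, `f` and the two projections is cartesian. -/
  isPullback : IsPullback F D.proj D'.proj f
  /-- `F` restricts to the identity on `M`. -/
  incl_comp : D.incl ≫ underlying F = D'.incl

end Deformation

/-! ## Base change -/

/-- The Koszul sign `ε(σ)`, defined by
`w_{σ(1)} ⊙ ⋯ ⊙ w_{σ(n)} = ε(σ) w₁ ⊙ ⋯ ⊙ w_n` for `wᵢ` homogeneous of degree `dᵢ`. -/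
def koszulSign {n : ℕ} (d : Fin n → ℤ) (σ : Equiv.Perm (Fin n)) : ℤˣ :=
  ∏ i, ∏ j, if i < j ∧ σ j < σ i then (-1 : ℤˣ) ^ (d (σ i) * d (σ j)) else 1

/-- For `I = (i₁, …, i_t)` with `i₁ + ⋯ + i_t = r`, all `i_j ≥ 1`, the element
`f_I(b₁, …, b_r) = 1/(I! t!) ∑ ε(σ) f_{i₁}(b_{σ(1)}, …) ⊙ ⋯ ⊙ f_{i_t}(…, b_{σ(r)})`
of `S(W)`, where the sum is over all permutations `σ` of `{1, …, r}`. -/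
noncomputable def multiCoeff [Algebra ℚ k] {V W : FormalSupermanifold.{u, v} k} (f : V ⟶ W)
    {r : ℕ} (I : Composition r) (d : Fin r → ℤ) (b : ∀ i, V.obj (d i)) : Sym W :=
  algebraMap ℚ k (((∏ j, (I.blocksFun j).factorial) * I.length.factorial : ℕ) : ℚ)⁻¹ •
    ∑ σ : Equiv.Perm (Fin r), koszulSign d σ •
      (List.ofFn fun j : Fin I.length =>
        Sym.ι W (coeff f (List.ofFn fun a : Fin (I.blocksFun j) =>
          Sym.gen V (d (σ (I.embedding j a))) (b (σ (I.embedding j a)))).prod)).prod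

/-- `Q` is the vectorfield pulled back from `Q'` along `f : B → B'`. Its Taylor coefficients are
`Q_{r+s}(b₁, …, b_r, m₁, …, m_s) = ∑_{t, I} Q'_{s+t}(f_I(b₁, …, b_r), m₁, …, m_s)` for `r ≥ 1`,
where the sum is over all `I ∈ ℕ_{≥1}^t` with `|I| = r`, and `Q_s(m₁, …, m_s) = 0`. -/
structure IsPulledBack [Algebra ℚ k] {M B B' : FormalSupermanifold.{u, v} k} (f : B ⟶ B')
    (Q' : Sym (B'.prod M) →ₗ[k] Sym (B'.prod M)) (Q : Sym (B.prod M) →ₗ[k] Sym (B.prod M)) :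
    Prop where
  coeff_base : ∀ (r s : ℕ), 1 ≤ r → ∀ (d : Fin r → ℤ) (b : ∀ i, B.obj (d i))
    (e : Fin s → ℤ) (m : ∀ j, M.obj (e j)),
    Sym.proj (B.prod M) (Q
      ((List.ofFn fun i => Sym.gen (B.prod M) (d i) (b i, 0)).prod *
        (List.ofFn fun j => Sym.gen (B.prod M) (e j) (0, m j)).prod)) =
    DirectSum.lmap (fun i => LinearMap.prod 0 (LinearMap.snd k (B'.obj i) (M.obj i)))
      (∑ I : Composition r, Sym.proj (B'.prod M) (Q'
        (FormalMap.toLin (inl B' M) (multiCoeff f I d b) *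
          (List.ofFn fun j => Sym.gen (B'.prod M) (e j) (0, m j)).prod)))
  coeff_fibre : ∀ (s : ℕ) (e : Fin s → ℤ) (m : ∀ j, M.obj (e j)),
    Sym.proj (B.prod M) (Q
      (List.ofFn fun j => Sym.gen (B.prod M) (e j) (0, m j)).prod) = 0

/-- `F : B × M → B' × M` is the map `f × Id`. -/
structure IsProdId {M B B' : FormalSupermanifold.{u, v} k} (f : B ⟶ B')
    (F : B.prod M ⟶ B'.prod M) : Prop where
  comp_fst : F ≫ fst B' M = fst B M ≫ f
  comp_snd : F ≫ snd B' M = snd B M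

end Basic
end FormalDG

/-! Coalgebra maps and coderivations of symmetric coalgebras are determined by their Taylor
coefficients. Every identity therefore reduces to an identity after `proj`, and on a product `B × M`
to one identity per factor.

Determinacy rests on the Euler operator `E = μ (ι pr ⊗ 1) Δ`, which multiplies the part of
polynomial degree `n` by `n`. If `Δ P = (P ⊗ F + G ⊗ P) Δ` and `pr P = 0`, then `E P` is the
convolution of `ι pr G` with `P`. Since `ι pr G` kills `1`, induction on the polynomial degree of
the argument gives `E P = 0`; moreover `ε P = 0`, so `P = 0` because `k` contains `ℚ`
(`Sym.eq_zero_of_skew`). This applies to the difference of two formal maps, to `F Q - Q' F`, and to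
`Q²` for odd `Q`. Conversely, coefficients of degree `1` extend to a coderivation
(`Sym.ofCoeff_isVectorField`), and the convolution of two coalgebra maps is a coalgebra map
(`FormalMap.add`), so that `A × B` is a categorical product. Both facts come from coassociativity
and graded cocommutativity.

The sum over all `I` of `f_I(b₁, …, b_r)` is simply the value of the coalgebra map `f` at `b₁ ⊙ ⋯ ⊙
b_r` (`sum_multiCoeff`): both sides satisfy the same recursion under `E`, and the sum over
permutations contributes exactly the factor `I!`. Hence the required `Q` is the coderivation with
coefficients `(0, pr_M Q' (f × Id))`, which gives its existence and uniqueness.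

The fields `Q^M` and `Q` have no component along `B`, so the projection to `B` is equivariant; by
the choice of `Q`, the map `f × Id` intertwines the total fields. The component of `Q̃²` along `B`
is then `(Q^B)²` and the one along `M` is that of `Q̃'² (f × Id)`, so both vanish. A cone `(a, b)`
over the square factors through the pair formed by `b` and the `M`-component of `a`; equivariance of
this pair is again checked on the two factors, after composing with `f × Id` for the second. -/

namespace FormalDG

section Basic

variable {k : Type u} [CommRing k]

/-! ### Graded bialgebra structure of `S(V)` -/

namespace Sym

variable {V W : FormalSupermanifold.{u, v} k}

section Units

variable {M N : Type*} [AddCommGroup M] [AddCommGroup N] [Module k M] [Module k N]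

theorem map_units_smul (φ : M →ₗ[k] N) (s : ℤˣ) (x : M) : φ (s • x) = s • φ x := by
  rw [Units.smul_def, map_zsmul, Units.smul_def]

theorem units_smul_tmul (s : ℤˣ) (x : M) (y : N) : (s • x) ⊗ₜ[k] y = s • (x ⊗ₜ[k] y) :=
  map_units_smul ((TensorProduct.mk k M N).flip y) s x

theorem tmul_units_smul (s : ℤˣ) (x : M) (y : N) : x ⊗ₜ[k] (s • y) = s • (x ⊗ₜ[k] y) :=
  map_units_smul (TensorProduct.mk k M N x) s y

end Units

/-- The product `a₁ ⊙ ⋯ ⊙ aₙ` of a list of homogeneous elements. -/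
noncomputable def mon (l : List (Σ i, V.obj i)) : Sym V :=
  (l.map fun a => gen V a.1 a.2).prod

@[simp] theorem mon_nil : mon ([] : List (Σ i, V.obj i)) = 1 := rfl

@[simp] theorem mon_cons (a : Σ i, V.obj i) (l : List (Σ i, V.obj i)) :
    mon (a :: l) = gen V a.1 a.2 * mon l := by simp [mon]

section Ext

variable {A : Type*} [AddCommMonoid A] [Module k A]

theorem hom_ext_degree {φ ψ : Sym V →ₗ[k] A}
    (h : ∀ d, ∀ x ∈ degree V d, φ x = ψ x) : φ = ψ := by
  ext x
  induction x using DirectSum.Decomposition.inductionOn (degree V) with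
  | zero => simp
  | homogeneous x => exact h _ _ x.2
  | add x y hx hy => rw [map_add, map_add, hx, hy]

theorem hom_ext_mon {φ ψ : Sym V →ₗ[k] A} (h : ∀ l, φ (mon l) = ψ (mon l)) : φ = ψ := by
  apply hom_ext_degree
  intro d x hx
  induction hx using Submodule.span_induction with
  | zero => simp
  | add x y _ _ hx hy => rw [map_add, map_add, hx, hy]
  | smul r x _ hx => rw [map_smul, map_smul, hx]
  | mem x hx =>
    obtain ⟨l, rfl, rfl⟩ := hx
    exact h l

/-- Monomials span `S(V)`, so linear identities can be proved by adjoining one generator at a time.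
This is the induction behind most coalgebra identities below. -/
theorem hom_ext_gen {φ ψ : Sym V →ₗ[k] A} (h1 : φ 1 = ψ 1)
    (h : ∀ i (a : V.obj i) x, φ x = ψ x → φ (gen V i a * x) = ψ (gen V i a * x)) :
    φ = ψ := by
  apply hom_ext_mon
  intro l
  induction l with
  | nil => exact h1
  | cons a l ih => rw [mon_cons]; exact h _ _ _ ih

theorem tensor_ext {φ ψ : Sym V ⊗[k] Sym W →ₗ[k] A}
    (h : ∀ i, ∀ x ∈ degree V i, ∀ j, ∀ y ∈ degree W j, φ (x ⊗ₜ y) = ψ (x ⊗ₜ y)) :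
    φ = ψ := by
  apply TensorProduct.ext
  apply hom_ext_degree
  intro i x hx
  apply hom_ext_degree
  intro j y hy
  exact h i x hx j y hy

end Ext

/-- The sign operator `x ↦ (-1)^{i|x|} x` on `S(V)`. -/
noncomputable def signBy (V : FormalSupermanifold.{u, v} k) (i : ℤ) : Sym V →ₐ[k] Sym V :=
  map fun j => (((-1 : ℤˣ) ^ (i * j) : ℤˣ) : ℤ) • LinearMap.id

theorem signBy_gen (i j : ℤ) (a : V.obj j) :
    signBy V i (gen V j a) = (-1 : ℤˣ) ^ (i * j) • gen V j a := by
  rw [signBy, map_gen, LinearMap.smul_apply, map_zsmul, Units.smul_def]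
  rfl

theorem signBy_of_mem (i : ℤ) {d : ℤ} {x : Sym V} (hx : x ∈ degree V d) :
    signBy V i x = (-1 : ℤˣ) ^ (i * d) • x := by
  induction hx using Submodule.span_induction with
  | zero => simp
  | add _ _ _ _ h h' => rw [map_add, h, h', smul_add]
  | smul r _ _ h => rw [map_smul, h, smul_comm]
  | mem x hx =>
    obtain ⟨l, rfl, rfl⟩ := hx
    induction l with
    | nil => simp
    | cons a l ih =>
      simp only [List.map_cons, List.prod_cons, List.sum_cons, map_mul, signBy_gen] at ih ⊢
      rw [ih, smul_mul_smul_comm, mul_add, uzpow_add]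

theorem sign_eq_signBy : sign V = signBy V 1 := by
  apply algHom_ext
  intro i a
  rw [signBy_gen, sign, map_gen, one_mul, LinearMap.smul_apply, map_zsmul, Units.smul_def]
  rfl

theorem sign_of_mem {d : ℤ} {x : Sym V} (hx : x ∈ degree V d) :
    sign V x = (-1 : ℤˣ) ^ d • x := by
  rw [sign_eq_signBy, signBy_of_mem 1 hx, one_mul]

/-- Putting the sign into the operator `signBy` allows a generator to be commuted past an element
that need not be homogeneous. -/
theorem gen_mul_eq (i : ℤ) (a : V.obj i) (x : Sym V) :
    gen V i a * x = signBy V i x * gen V i a := by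
  have h : LinearMap.mulLeft k (gen V i a) =
      LinearMap.mulRight k (gen V i a) ∘ₗ (signBy V i).toLinearMap := by
    apply hom_ext_gen
    · simp
    · intro j b x ih
      simp only [LinearMap.mulLeft_apply, LinearMap.comp_apply, AlgHom.toLinearMap_apply,
        LinearMap.mulRight_apply, map_mul, signBy_gen] at ih ⊢
      rw [← mul_assoc, gen_mul_gen, smul_mul_assoc, mul_assoc, ih, smul_mul_assoc,
        smul_mul_assoc, mul_assoc]
  exact LinearMap.congr_fun h x

/-- The product `(a ⊗ b)(a' ⊗ b') = (-1)^{|b||a'|} aa' ⊗ bb'` on `S(V) ⊗ S(V)`. -/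
noncomputable def gmul (V : FormalSupermanifold.{u, v} k) :
    Sym V ⊗[k] Sym V →ₗ[k] Sym V ⊗[k] Sym V →ₗ[k] Sym V ⊗[k] Sym V :=
  GradedTensorProduct.mulHom (degree V) (degree V)

theorem gmul_tmul {i j : ℤ} (x : Sym V) {y : Sym V} (hy : y ∈ degree V i) {x' : Sym V}
    (hx' : x' ∈ degree V j) (y' : Sym V) :
    gmul V (x ⊗ₜ y) (x' ⊗ₜ y') = (-1 : ℤˣ) ^ (i * j) • ((x * x') ⊗ₜ[k] (y * y')) :=
  GradedTensorProduct.tmul_coe_mul_coe_tmul (degree V) (degree V) x ⟨y, hy⟩ ⟨x', hx'⟩ y'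

theorem comul_mul (x y : Sym V) : comul V (x * y) = gmul V (comul V x) (comul V y) :=
  map_mul (comulAlg V) x y

theorem one_mem_degree : (1 : Sym V) ∈ degree V 0 := SetLike.GradedOne.one_mem

@[simp]
theorem comul_one : comul V (1 : Sym V) = 1 ⊗ₜ 1 := _root_.map_one (comulAlg V)

theorem comul_gen (i : ℤ) (a : V.obj i) :
    comul V (gen V i a) = gen V i a ⊗ₜ 1 + 1 ⊗ₜ gen V i a :=
  comulAlg_gen i a

/-- The operator `a ⊗ 1 + 1 ⊗ a` on `S(V) ⊗ S(V)`. -/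
noncomputable def genAct (i : ℤ) (a : V.obj i) :
    Sym V ⊗[k] Sym V →ₗ[k] Sym V ⊗[k] Sym V :=
  TensorProduct.map (LinearMap.mulLeft k (gen V i a)) LinearMap.id +
    TensorProduct.map (signBy V i).toLinearMap (LinearMap.mulLeft k (gen V i a))

/-- Only the term `1 ⊗ a` has to pass a left factor, which produces `signBy`. Written as a sum of
tensor products of operators, multiplication by `Δ a` can be pushed through tensor maps. -/
theorem gmul_comul_gen (i : ℤ) (a : V.obj i) : gmul V (comul V (gen V i a)) = genAct i a := by
  apply tensor_ext
  intro d y hy e z hz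
  rw [comul_gen, map_add, LinearMap.add_apply, gmul_tmul _ one_mem_degree hy,
    gmul_tmul _ (gen_mem V i a) hy]
  simp only [genAct, LinearMap.add_apply, TensorProduct.map_tmul, LinearMap.mulLeft_apply,
    LinearMap.id_apply, AlgHom.toLinearMap_apply, signBy_of_mem i hy, zero_mul, uzpow_zero,
    one_smul, one_mul, units_smul_tmul]

theorem comul_gen_mul (i : ℤ) (a : V.obj i) (x : Sym V) :
    comul V (gen V i a * x) = genAct i a (comul V x) := by
  rw [comul_mul, gmul_comul_gen]

@[simp]
theorem counit_gen (i : ℤ) (a : V.obj i) : counit V (gen V i a) = 0 := by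
  rw [counit, lift_gen]; rfl

theorem signBy_counit (i : ℤ) (x : Sym V) : counit V (signBy V i x) = counit V x :=
  counit_map _ x

theorem counit_comul_left (x : Sym V) :
    TensorProduct.map (counit V).toLinearMap LinearMap.id (comul V x) = 1 ⊗ₜ x := by
  have h : TensorProduct.map (counit V).toLinearMap LinearMap.id ∘ₗ comul V =
      TensorProduct.mk k k (Sym V) 1 := by
    apply hom_ext_gen
    · simp
    · intro i a x ih
      have key : TensorProduct.map (counit V).toLinearMap LinearMap.id ∘ₗ genAct i a =
          TensorProduct.map LinearMap.id (LinearMap.mulLeft k (gen V i a)) ∘ₗ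
            TensorProduct.map (counit V).toLinearMap LinearMap.id := by
        apply TensorProduct.ext'
        intro y z
        simp [genAct, signBy_counit]
      rw [LinearMap.comp_apply, comul_gen_mul, ← LinearMap.comp_apply, key]
      rw [LinearMap.comp_apply] at ih ⊢
      rw [ih]
      simp
  exact LinearMap.congr_fun h x

theorem counit_comul_right (x : Sym V) :
    TensorProduct.map LinearMap.id (counit V).toLinearMap (comul V x) = x ⊗ₜ 1 := by
  have h : TensorProduct.map LinearMap.id (counit V).toLinearMap ∘ₗ comul V =
      (TensorProduct.mk k (Sym V) k).flip 1 := by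
    apply hom_ext_gen
    · simp
    · intro i a x ih
      have key : TensorProduct.map LinearMap.id (counit V).toLinearMap ∘ₗ genAct i a =
          TensorProduct.map (LinearMap.mulLeft k (gen V i a)) LinearMap.id ∘ₗ
            TensorProduct.map LinearMap.id (counit V).toLinearMap := by
        apply TensorProduct.ext'
        intro y z
        simp [genAct]
      rw [LinearMap.comp_apply, comul_gen_mul, ← LinearMap.comp_apply, key]
      rw [LinearMap.comp_apply] at ih ⊢
      rw [ih]
      simp
  exact LinearMap.congr_fun h x

theorem comul_signBy (i : ℤ) (x : Sym V) :
    comul V (signBy V i x) =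
      TensorProduct.map (signBy V i).toLinearMap (signBy V i).toLinearMap (comul V x) :=
  comul_map _ x

theorem coassoc (x : Sym V) :
    TensorProduct.assoc k _ _ _ (TensorProduct.map (comul V) LinearMap.id (comul V x)) =
      TensorProduct.map LinearMap.id (comul V) (comul V x) := by
  have h : (TensorProduct.assoc k _ _ _).toLinearMap ∘ₗ
      TensorProduct.map (comul V) LinearMap.id ∘ₗ comul V =
      TensorProduct.map LinearMap.id (comul V) ∘ₗ comul V := by
    apply hom_ext_gen
    · simp
    · intro i a x ih
      -- `L` is left multiplication by `a ⊗ 1 ⊗ 1 + 1 ⊗ a ⊗ 1 + 1 ⊗ 1 ⊗ a`, with Koszul signs; both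
      -- iterated coproducts intertwine multiplication by `a` with it.
      let L : Sym V ⊗[k] (Sym V ⊗[k] Sym V) →ₗ[k] Sym V ⊗[k] (Sym V ⊗[k] Sym V) :=
        TensorProduct.map (LinearMap.mulLeft k (gen V i a)) LinearMap.id +
          TensorProduct.map (signBy V i).toLinearMap (genAct i a)
      have h1 : TensorProduct.map LinearMap.id (comul V) ∘ₗ genAct i a =
          L ∘ₗ TensorProduct.map LinearMap.id (comul V) := by
        apply TensorProduct.ext'
        intro y z
        simp [L, genAct, comul_gen_mul]
      have h2 : (TensorProduct.assoc k _ _ _).toLinearMap ∘ₗ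
          TensorProduct.map (genAct i a) LinearMap.id +
          (TensorProduct.assoc k _ _ _).toLinearMap ∘ₗ
          TensorProduct.map (TensorProduct.map (signBy V i).toLinearMap
            (signBy V i).toLinearMap) (LinearMap.mulLeft k (gen V i a)) =
          L ∘ₗ (TensorProduct.assoc k _ _ _).toLinearMap := by
        apply TensorProduct.ext_threefold
        intro y z w
        simp [L, genAct, TensorProduct.add_tmul, TensorProduct.tmul_add, add_assoc]
      have h3 : (TensorProduct.assoc k _ _ _).toLinearMap ∘ₗ
          TensorProduct.map (comul V) LinearMap.id ∘ₗ genAct i a =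
          L ∘ₗ (TensorProduct.assoc k _ _ _).toLinearMap ∘ₗ
            TensorProduct.map (comul V) LinearMap.id := by
        rw [← LinearMap.comp_assoc _ _ L, ← h2]
        apply TensorProduct.ext'
        intro y z
        simp [genAct, comul_gen_mul, comul_signBy, TensorProduct.add_tmul]
      have h1' := LinearMap.congr_fun h1 (comul V x)
      have h3' := LinearMap.congr_fun h3 (comul V x)
      simp only [LinearMap.comp_apply] at h1' h3' ih ⊢
      rw [comul_gen_mul, h1', h3', ih]
  exact LinearMap.congr_fun h x

/-- The symmetry `x ⊗ y ↦ (-1)^{|x||y|} y ⊗ x` of `S(V) ⊗ S(V)`. -/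
noncomputable def twist (V : FormalSupermanifold.{u, v} k) :
    Sym V ⊗[k] Sym V →ₗ[k] Sym V ⊗[k] Sym V :=
  (GradedTensorProduct.comm (degree V) (degree V)).toLinearMap

theorem twist_tmul {i j : ℤ} {x y : Sym V} (hx : x ∈ degree V i) (hy : y ∈ degree V j) :
    twist V (x ⊗ₜ y) = (-1 : ℤˣ) ^ (j * i) • (y ⊗ₜ[k] x) :=
  GradedTensorProduct.comm_coe_tmul_coe (degree V) (degree V) ⟨x, hx⟩ ⟨y, hy⟩

/-- The twist is an algebra automorphism for the Koszul product, so cocommutativity only has to be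
seen on generators. -/
theorem twist_comul (x : Sym V) : twist V (comul V x) = comul V x := by
  have h : (GradedTensorProduct.comm (degree V) (degree V)).toAlgHom.comp (comulAlg V) =
      comulAlg V := by
    apply algHom_ext
    intro i a
    have h1 := twist_tmul (gen_mem V i a) (one_mem_degree (V := V))
    have h2 := twist_tmul (one_mem_degree (V := V)) (gen_mem V i a)
    rw [zero_mul, uzpow_zero, one_smul] at h1
    rw [mul_zero, uzpow_zero, one_smul] at h2
    have h3 : twist V (comul V (gen V i a)) = comul V (gen V i a) := by
      rw [comul_gen, map_add, h1, h2, add_comm]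
    exact h3
  exact DFunLike.congr_fun h x

end Sym

namespace Sym

variable {V W : FormalSupermanifold.{u, v} k}

/-! ### The projection to `V` -/

theorem ι_hom (i : ℤ) (a : V.obj i) : ι V (V.hom i a) = gen V i a := rfl

@[simp]
theorem counit_ι (x : V.Total) : counit V (ι V x) = 0 := by rw [counit, lift_ι]; rfl

theorem proj_ι_mul (v : V.Total) (x : Sym V) : proj V (ι V v * x) = counit V x • v := by
  have hz : ∀ i j (a : V.obj i) (b : V.obj j),
      projAux V (V.hom i a) * projAux V (V.hom j b) =
        (-1 : ℤˣ) ^ (i * j) • (projAux V (V.hom j b) * projAux V (V.hom i a)) := by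
    intro i j a b
    have h : ∀ v w, projAux V v * projAux V w = 0 := by
      intro v w
      apply LinearMap.ext
      intro x
      simp [projAux]
    rw [h, h, smul_zero]
  -- In the action on `k × V` that defines `proj`, the first coordinate of `x · (1, 0)` is `ε(x)`; a
  -- further `v` moves it to the second coordinate.
  have h1 : LinearMap.fst k k V.Total ∘ₗ LinearMap.applyₗ ((1, 0) : k × V.Total) ∘ₗ
      (lift (projAux V) hz).toLinearMap = (counit V).toLinearMap := by
    apply hom_ext_gen
    · simp
    · intro i a x _
      simp [projAux]
  have h2 := LinearMap.congr_fun h1 x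
  simp only [LinearMap.comp_apply, LinearMap.applyₗ_apply_apply, LinearMap.fst_apply,
    AlgHom.toLinearMap_apply] at h2
  change (lift (projAux V) hz (ι V v * x) (1, 0)).2 = _
  rw [map_mul, lift_ι, Module.End.mul_apply, ← h2]
  simp [projAux]

@[simp]
theorem proj_one : proj V (1 : Sym V) = 0 := by simp [proj]

theorem proj_gen_mul (i : ℤ) (a : V.obj i) (x : Sym V) :
    proj V (gen V i a * x) = counit V x • V.hom i a := proj_ι_mul _ _

@[simp]
theorem proj_ι (v : V.Total) : proj V (ι V v) = v := by
  have h := proj_ι_mul v (1 : Sym V)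
  rwa [mul_one, _root_.map_one, one_smul] at h

theorem map_ι (φ : ∀ i, V.obj i →ₗ[k] W.obj i) (v : V.Total) :
    map φ (ι V v) = ι W (DirectSum.lmap φ v) := by
  rw [map, lift_ι]; rfl

theorem lmap_hom (φ : ∀ i, V.obj i →ₗ[k] W.obj i) (i : ℤ) (a : V.obj i) :
    DirectSum.lmap φ (V.hom i a) = W.hom i (φ i a) :=
  DirectSum.lmap_lof φ i a

theorem proj_map (φ : ∀ i, V.obj i →ₗ[k] W.obj i) (x : Sym V) :
    proj W (map φ x) = DirectSum.lmap φ (proj V x) := by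
  have h : proj W ∘ₗ (map φ).toLinearMap = DirectSum.lmap φ ∘ₗ proj V := by
    apply hom_ext_gen
    · simp
    · intro i a x _
      simp only [LinearMap.comp_apply, AlgHom.toLinearMap_apply, map_mul, map_gen,
        proj_gen_mul, counit_map, map_smul, lmap_hom]
  exact LinearMap.congr_fun h x

theorem proj_mem_range {d : ℤ} {x : Sym V} (hx : x ∈ degree V d) :
    proj V x ∈ LinearMap.range (V.hom d) := by
  induction hx using Submodule.span_induction with
  | zero => simp
  | add _ _ _ _ h h' => rw [map_add]; exact add_mem h h'
  | smul r _ _ h => rw [map_smul]; exact Submodule.smul_mem _ r h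
  | mem x hx =>
    obtain ⟨l, rfl, rfl⟩ := hx
    rcases l with _ | ⟨a, _ | ⟨b, l⟩⟩
    · simp
    · obtain ⟨i, a⟩ := a
      have hi : (List.map Sigma.fst [(⟨i, a⟩ : Σ i, V.obj i)]).sum = i := by simp
      rw [hi, List.map_cons, List.map_nil, List.prod_singleton, ← ι_hom, proj_ι]
      exact ⟨a, rfl⟩
    · simp [proj_gen_mul]

/-! ### Convolution -/

section Conv

variable {A : Type*} [Ring A] [Algebra k A]

/-- The convolution product `φ ⋆ ψ = μ (φ ⊗ ψ) Δ`. -/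
noncomputable def conv (φ ψ : Sym V →ₗ[k] A) : Sym V →ₗ[k] A :=
  LinearMap.mul' k A ∘ₗ TensorProduct.map φ ψ ∘ₗ comul V

theorem conv_apply (φ ψ : Sym V →ₗ[k] A) (x : Sym V) :
    conv φ ψ x = LinearMap.mul' k A (TensorProduct.map φ ψ (comul V x)) := rfl

theorem conv_sum_right {ι' : Type*} (s : Finset ι') (φ : Sym V →ₗ[k] A)
    (ψ : ι' → Sym V →ₗ[k] A) : conv φ (∑ i ∈ s, ψ i) = ∑ i ∈ s, conv φ (ψ i) := by
  ext x
  simp only [conv_apply, ← TensorProduct.mapBilinear_apply, map_sum, LinearMap.sum_apply]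

theorem conv_zero_left (ψ : Sym V →ₗ[k] A) : conv 0 ψ = 0 := by
  ext x; simp [conv]

theorem conv_zero_right (φ : Sym V →ₗ[k] A) : conv φ 0 = 0 := by
  ext x; simp [conv]

theorem conv_one (φ ψ : Sym V →ₗ[k] A) : conv φ ψ 1 = φ 1 * ψ 1 := by
  simp [conv_apply]

theorem conv_gen_mul (φ ψ : Sym V →ₗ[k] A) (i : ℤ) (a : V.obj i) (x : Sym V) :
    conv φ ψ (gen V i a * x) =
      conv (φ ∘ₗ LinearMap.mulLeft k (gen V i a)) ψ x +
        conv (φ ∘ₗ (signBy V i).toLinearMap) (ψ ∘ₗ LinearMap.mulLeft k (gen V i a)) x := by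
  simp only [conv_apply]
  rw [comul_gen_mul, genAct, LinearMap.add_apply, map_add, map_add, TensorProduct.map_map,
    TensorProduct.map_map, LinearMap.comp_id]

theorem conv_counit_left (a : A) (ψ : Sym V →ₗ[k] A) (x : Sym V) :
    conv ((counit V).toLinearMap.smulRight a) ψ x = a * ψ x := by
  have h : (counit V).toLinearMap.smulRight a =
      ((LinearMap.id : k →ₗ[k] k).smulRight a) ∘ₗ (counit V).toLinearMap := by
    ext; simp
  rw [conv_apply, h, ← LinearMap.comp_id ψ, TensorProduct.map_comp, LinearMap.comp_apply,
    counit_comul_left]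
  simp

end Conv

/-- The sign from carrying `a` past the first tensor factor cancels the one from moving `a` back to
the front of the product; this needs `φ` to commute with `signBy`. -/
theorem conv_mulLeft (φ : Sym V →ₗ[k] Sym V) (i : ℤ) (a : V.obj i) (ψ : Sym V →ₗ[k] Sym V)
    (hφ : ∀ x, φ (signBy V i x) = signBy V i (φ x)) (x : Sym V) :
    conv (φ ∘ₗ (signBy V i).toLinearMap) (LinearMap.mulLeft k (gen V i a) ∘ₗ ψ) x =
      gen V i a * conv φ ψ x := by
  refine LinearMap.congr_fun (?_ : LinearMap.mul' k (Sym V) ∘ₗ TensorProduct.map _ _ =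
    LinearMap.mulLeft k (gen V i a) ∘ₗ LinearMap.mul' k (Sym V) ∘ₗ TensorProduct.map φ ψ)
    (comul V x)
  apply TensorProduct.ext'
  intro y z
  simp only [LinearMap.comp_apply, TensorProduct.map_tmul, LinearMap.mul'_apply,
    LinearMap.mulLeft_apply, AlgHom.toLinearMap_apply, hφ]
  rw [← mul_assoc, ← gen_mul_eq, mul_assoc]

/-! ### The polynomial grading -/

/-- Multiplication by `Tⁿ` on the part of polynomial degree `n`. -/
noncomputable def polyHom (V : FormalSupermanifold.{u, v} k) :
    Sym V →ₐ[k] Polynomial (Sym V) :=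
  lift ((Polynomial.monomial 1).restrictScalars k ∘ₗ ι V) (by
    intro i j a b
    simp only [LinearMap.comp_apply, ι_hom, LinearMap.restrictScalars_apply,
      Polynomial.monomial_mul_monomial]
    rw [gen_mul_gen, Units.smul_def, map_zsmul, Units.smul_def])

/-- The projection of `S(V)` to its part of polynomial degree `n`. -/
noncomputable def polyPart (V : FormalSupermanifold.{u, v} k) (n : ℕ) :
    Sym V →ₗ[k] Sym V :=
  (Polynomial.lcoeff (Sym V) n).restrictScalars k ∘ₗ (polyHom V).toLinearMap

theorem polyHom_gen (i : ℤ) (a : V.obj i) :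
    polyHom V (gen V i a) = Polynomial.monomial 1 (gen V i a) := by
  rw [polyHom, lift_gen]; rfl

theorem polyPart_one (n : ℕ) : polyPart V n 1 = if n = 0 then 1 else 0 := by
  simp [polyPart, Polynomial.coeff_one]

theorem polyPart_zero_gen_mul (i : ℤ) (a : V.obj i) (x : Sym V) :
    polyPart V 0 (gen V i a * x) = 0 := by
  simp [polyPart, polyHom_gen]

theorem polyPart_succ_gen_mul (n : ℕ) (i : ℤ) (a : V.obj i) (x : Sym V) :
    polyPart V (n + 1) (gen V i a * x) = gen V i a * polyPart V n x := by
  simp only [polyPart, LinearMap.comp_apply, AlgHom.toLinearMap_apply, map_mul, polyHom_gen,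
    LinearMap.restrictScalars_apply, Polynomial.lcoeff_apply]
  rw [Polynomial.coeff_monomial_mul]

theorem polyPart_mon (n : ℕ) (l : List (Σ i, V.obj i)) :
    polyPart V n (mon l) = if l.length = n then mon l else 0 := by
  induction l generalizing n with
  | nil => simp [polyPart_one, eq_comm]
  | cons a l ih =>
    cases n with
    | zero => simp [polyPart_zero_gen_mul]
    | succ n => simp [polyPart_succ_gen_mul, ih, mul_ite]

theorem polyPart_zero (x : Sym V) : polyPart V 0 x = counit V x • 1 := by
  have h : polyPart V 0 = (counit V).toLinearMap.smulRight 1 := by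
    apply hom_ext_gen
    · simp [polyPart_one]
    · intro i a x _
      simp [polyPart_zero_gen_mul]
  exact LinearMap.congr_fun h x

theorem polyPart_polyPart (m n : ℕ) (x : Sym V) :
    polyPart V m (polyPart V n x) = if m = n then polyPart V n x else 0 := by
  have h : polyPart V m ∘ₗ polyPart V n = if m = n then polyPart V n else 0 := by
    apply hom_ext_mon
    intro l
    rw [LinearMap.comp_apply, polyPart_mon]
    by_cases h1 : l.length = n
    · rw [if_pos h1, polyPart_mon]
      by_cases h2 : m = n
      · rw [if_pos h2, polyPart_mon, h2]
      · rw [if_neg h2, h1, if_neg (Ne.symm h2)]; rfl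
    · rw [if_neg h1, map_zero]
      by_cases h2 : m = n
      · rw [if_pos h2, polyPart_mon, if_neg h1]
      · rw [if_neg h2]; rfl
  rw [← LinearMap.comp_apply, h]
  split_ifs <;> rfl

theorem hom_eq_zero {A : Type*} [AddCommMonoid A] [Module k A] {P : Sym V →ₗ[k] A}
    (h : ∀ n x, P (polyPart V n x) = 0) : P = 0 := by
  apply hom_ext_mon
  intro l
  have := h l.length (mon l)
  rwa [polyPart_mon, if_pos rfl] at this

theorem polyHom_mon (l : List (Σ i, V.obj i)) :
    polyHom V (mon l) = Polynomial.monomial l.length (mon l) := by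
  induction l with
  | nil => simp
  | cons a l ih =>
    rw [mon_cons, map_mul, ih, polyHom_gen, Polynomial.monomial_mul_monomial, List.length_cons,
      add_comm]

/-- Evaluation at `T = 1` is a left inverse of `polyHom`, so the polynomial components determine an
element. -/
theorem eq_zero_of_polyPart {x : Sym V} (h : ∀ n, polyPart V n x = 0) : x = 0 := by
  have h1 : ((Polynomial.leval (1 : Sym V)).restrictScalars k) ∘ₗ (polyHom V).toLinearMap =
      LinearMap.id := by
    apply hom_ext_mon
    intro l
    simp [polyHom_mon]
  have h2 : polyHom V x = 0 := Polynomial.ext fun n => h n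
  have h3 := LinearMap.congr_fun h1 x
  simpa [h2] using h3.symm

theorem polyPart_map (φ : ∀ i, V.obj i →ₗ[k] W.obj i) (n : ℕ) (x : Sym V) :
    polyPart W n (map φ x) = map φ (polyPart V n x) := by
  have h : ∀ n, polyPart W n ∘ₗ (map φ).toLinearMap = (map φ).toLinearMap ∘ₗ polyPart V n := by
    intro n
    apply hom_ext_mon
    intro l
    induction l generalizing n with
    | nil => simp [polyPart_one, apply_ite (map φ)]
    | cons a l ih =>
      simp only [LinearMap.comp_apply, AlgHom.toLinearMap_apply, mon_cons, map_mul,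
        map_gen] at ih ⊢
      cases n with
      | zero => simp [polyPart_zero_gen_mul]
      | succ n => rw [polyPart_succ_gen_mul, polyPart_succ_gen_mul, ih, map_mul, map_gen]
  exact LinearMap.congr_fun (h n) x

theorem comul_polyPart (n : ℕ) (x : Sym V) :
    comul V (polyPart V n x) = ∑ p ∈ Finset.HasAntidiagonal.antidiagonal n,
      TensorProduct.map (polyPart V p.1) (polyPart V p.2) (comul V x) := by
  have h : ∀ n, comul V ∘ₗ polyPart V n = (∑ p ∈ Finset.HasAntidiagonal.antidiagonal n,
      TensorProduct.map (polyPart V p.1) (polyPart V p.2)) ∘ₗ comul V := by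
    intro n
    apply hom_ext_mon
    intro l
    induction l generalizing n with
    | nil =>
      rw [mon_nil, LinearMap.comp_apply, LinearMap.comp_apply, polyPart_one, comul_one]
      cases n with
      | zero => simp [polyPart_one]
      | succ n =>
        simp only [LinearMap.sum_apply, TensorProduct.map_tmul, polyPart_one]
        rw [if_neg (by omega), map_zero, Finset.sum_eq_zero]
        rintro ⟨i, j⟩ hp
        rw [Finset.HasAntidiagonal.mem_antidiagonal] at hp
        rcases Nat.eq_zero_or_pos i with hi | hi
        · rw [if_neg (c := j = 0) (by omega), TensorProduct.tmul_zero]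
        · rw [if_neg (by omega), TensorProduct.zero_tmul]
    | cons a l ih =>
      obtain ⟨i, a⟩ := a
      rw [mon_cons, LinearMap.comp_apply, LinearMap.comp_apply, comul_gen_mul]
      have hs : ∀ m x, polyPart V m (signBy V i x) = signBy V i (polyPart V m x) :=
        polyPart_map _
      cases n with
      | zero =>
        rw [polyPart_zero_gen_mul, map_zero, eq_comm, ← LinearMap.comp_apply]
        refine LinearMap.congr_fun (?_ : _ = (0 : Sym V ⊗[k] Sym V →ₗ[k] Sym V ⊗[k] Sym V)) _
        apply TensorProduct.ext'
        intro y z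
        simp [genAct, polyPart_zero_gen_mul]
      | succ n =>
        have ih' := ih n
        rw [LinearMap.comp_apply, LinearMap.comp_apply] at ih'
        rw [polyPart_succ_gen_mul, comul_gen_mul, ih']
        refine LinearMap.congr_fun (?_ : genAct i a ∘ₗ (∑ p ∈ Finset.HasAntidiagonal.antidiagonal n,
          TensorProduct.map (polyPart V p.1) (polyPart V p.2)) = (∑ p ∈
          Finset.HasAntidiagonal.antidiagonal (n + 1),
            TensorProduct.map (polyPart V p.1) (polyPart V p.2)) ∘ₗ genAct i a) (comul V (mon l))
        apply TensorProduct.ext'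
        intro y z
        simp only [genAct, LinearMap.comp_apply, LinearMap.sum_apply, LinearMap.add_apply,
          map_sum, map_add, TensorProduct.map_tmul, LinearMap.mulLeft_apply,
          AlgHom.toLinearMap_apply, LinearMap.id_apply, Finset.sum_add_distrib]
        rw [Finset.Nat.sum_antidiagonal_succ, Finset.Nat.sum_antidiagonal_succ']
        simp [polyPart_zero_gen_mul, polyPart_succ_gen_mul, hs]
  have := LinearMap.congr_fun (h n) x
  simpa using this

theorem conv_polyPart {A : Type*} [Ring A] [Algebra k A] (φ ψ : Sym V →ₗ[k] A) (n : ℕ)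
    (x : Sym V) : conv φ ψ (polyPart V n x) = ∑ p ∈ Finset.HasAntidiagonal.antidiagonal n,
      conv (φ ∘ₗ polyPart V p.1) (ψ ∘ₗ polyPart V p.2) x := by
  simp only [conv_apply]
  rw [comul_polyPart, map_sum, map_sum]
  simp only [TensorProduct.map_map]

/-! ### The Euler operator and determinacy by Taylor coefficients -/

theorem ι_proj_signBy (i : ℤ) (x : Sym V) :
    ι V (proj V (signBy V i x)) = signBy V i (ι V (proj V x)) := by
  rw [signBy, proj_map, map_ι]

/-- Each of the `n + 1` letters of a monomial can be split off to the left, and multiplying it back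
restores the monomial together with its sign. -/
theorem conv_proj_polyPart (n : ℕ) (x : Sym V) :
    conv (ι V ∘ₗ proj V) (polyPart V n) x = (n + 1 : ℕ) • polyPart V (n + 1) x := by
  have h : ∀ n, conv (ι V ∘ₗ proj V) (polyPart V n) = (n + 1 : ℕ) • polyPart V (n + 1) := by
    intro n
    apply hom_ext_mon
    intro l
    induction l generalizing n with
    | nil => simp [conv_one, polyPart_one]
    | cons a l ih =>
      obtain ⟨i, a⟩ := a
      rw [mon_cons, conv_gen_mul]
      have h1 : (ι V ∘ₗ proj V) ∘ₗ LinearMap.mulLeft k (gen V i a) =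
          (counit V).toLinearMap.smulRight (gen V i a) := by
        ext x
        simp [proj_gen_mul, ι_hom]
      rw [h1, conv_counit_left, LinearMap.smul_apply, polyPart_succ_gen_mul]
      cases n with
      | zero =>
        have h2 : polyPart V 0 ∘ₗ LinearMap.mulLeft k (gen V i a) = 0 := by
          ext x
          simp [polyPart_zero_gen_mul]
        rw [h2, conv_zero_right]
        simp
      | succ n =>
        have h2 : polyPart V (n + 1) ∘ₗ LinearMap.mulLeft k (gen V i a) =
            LinearMap.mulLeft k (gen V i a) ∘ₗ polyPart V n := by
          ext x
          simp [polyPart_succ_gen_mul]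
        rw [h2, conv_mulLeft _ _ _ _ (ι_proj_signBy i), ih, LinearMap.smul_apply,
          mul_smul_comm, add_smul (n + 1) 1, one_smul, add_comm]
  exact LinearMap.congr_fun (h n) x

/-- The Euler operator multiplies the part of polynomial degree `n` by `n`. -/
theorem conv_proj_id (n : ℕ) (x : Sym V) :
    polyPart V n (conv (ι V ∘ₗ proj V) LinearMap.id x) = n • polyPart V n x := by
  have h : polyPart V n ∘ₗ conv (ι V ∘ₗ proj V) LinearMap.id = n • polyPart V n := by
    apply hom_ext_mon
    intro l
    rw [LinearMap.comp_apply, LinearMap.smul_apply]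
    have h2 : conv (ι V ∘ₗ proj V) LinearMap.id (mon l) = l.length • mon l := by
      induction l with
      | nil => simp [conv_one]
      | cons a l ih =>
        obtain ⟨i, a⟩ := a
        rw [mon_cons, conv_gen_mul]
        have h1 : (ι V ∘ₗ proj V) ∘ₗ LinearMap.mulLeft k (gen V i a) =
            (counit V).toLinearMap.smulRight (gen V i a) := by
          ext x
          simp [proj_gen_mul, ι_hom]
        rw [h1, conv_counit_left, LinearMap.id_comp, ← LinearMap.comp_id
          (LinearMap.mulLeft k (gen V i a)), conv_mulLeft _ _ _ _ (ι_proj_signBy i), ih]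
        rw [List.length_cons, add_smul, one_smul, add_comm, mul_smul_comm, LinearMap.id_apply]
    rw [h2, map_nsmul, polyPart_mon]
    split_ifs with h3
    · rw [h3]
    · simp
  exact LinearMap.congr_fun h x

/-- Determinacy uses `ℚ ⊆ k` through this cancellation: the eigenvalues `n ≥ 1` of the Euler
operator are invertible. -/
theorem smul_cancel [Algebra ℚ k] {A : Type*} [AddCommGroup A] [Module k A] {n : ℕ}
    (hn : n ≠ 0) {x : A} (h : n • x = 0) : x = 0 := by
  have h1 : algebraMap ℚ k (n : ℚ)⁻¹ • (n : k) • x = x := by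
    rw [smul_smul, ← map_natCast (algebraMap ℚ k), ← map_mul,
      inv_mul_cancel₀ (Nat.cast_ne_zero.mpr hn), _root_.map_one, one_smul]
  rw [← h1, Nat.cast_smul_eq_nsmul, h, smul_zero]

theorem eq_zero_of_euler [Algebra ℚ k] {x : Sym V}
    (h : conv (ι V ∘ₗ proj V) LinearMap.id x = 0) (h0 : counit V x = 0) : x = 0 := by
  apply eq_zero_of_polyPart
  intro n
  rcases Nat.eq_zero_or_pos n with rfl | hn
  · rw [polyPart_zero, h0, zero_smul]
  · apply smul_cancel hn.ne' (k := k)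
    rw [← conv_proj_id, h, map_zero]

/-- On polynomial degree `n` the convolution `q ⋆ P` involves `P` only in degrees `j < n`, because
`q` vanishes in degree `0`. By induction the Euler operator kills the values of `P`, and the counit
condition excludes its kernel in degree `0`. -/
theorem hom_eq_zero_of_euler [Algebra ℚ k] {P q : Sym V →ₗ[k] Sym W} (hq : q 1 = 0)
    (h0 : ∀ x, counit W (P x) = 0)
    (h : ∀ x, conv (ι W ∘ₗ proj W) LinearMap.id (P x) = conv q P x) : P = 0 := by
  apply hom_eq_zero
  intro n
  induction n using Nat.strong_induction_on with
  | _ n ih =>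
    intro x
    apply eq_zero_of_euler _ (h0 _)
    rw [h, conv_polyPart, Finset.sum_eq_zero]
    rintro ⟨i, j⟩ hp
    rw [Finset.HasAntidiagonal.mem_antidiagonal] at hp
    rcases Nat.eq_zero_or_pos i with hi | hi
    · have : q ∘ₗ polyPart V i = 0 := by
        ext x
        simp [hi, polyPart_zero, hq]
      rw [this, conv_zero_left]; rfl
    · have : P ∘ₗ polyPart V j = 0 := by
        ext x
        exact ih j (by simp only at hp; omega) x
      rw [this, conv_zero_right]; rfl

theorem counit_mul_comul (x : Sym V) :
    conv (counit V).toLinearMap (counit V).toLinearMap x = counit V x := by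
  have h : (counit V).toLinearMap = (counit V).toLinearMap.smulRight 1 := by
    ext; simp
  conv_lhs => rw [h]
  rw [← h]
  nth_rw 1 [h]
  rw [conv_counit_left, one_mul]
  rfl

/-- A map `P` with `Δ P = (P ⊗ F + G ⊗ P) Δ` vanishes if its Taylor coefficients do. -/
theorem eq_zero_of_skew [Algebra ℚ k] {P F G : Sym V →ₗ[k] Sym W} (hG : G 1 = 1)
    (hFε : ∀ x, counit W (F x) = counit V x) (hGε : ∀ x, counit W (G x) = counit V x)
    (h : ∀ x, comul W (P x) = TensorProduct.map P F (comul V x) +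
      TensorProduct.map G P (comul V x))
    (hP : ∀ x, proj W (P x) = 0) : P = 0 := by
  apply hom_eq_zero_of_euler (q := (ι W ∘ₗ proj W) ∘ₗ G)
  · simp [hG]
  · intro x
    -- Applying `ε ⊗ ε` to the skew identity gives `ε P = ε P + ε P`.
    have h1 := counit_mul_comul (P x)
    have hF' : (counit W).toLinearMap ∘ₗ F = (counit V).toLinearMap := LinearMap.ext hFε
    have hG' : (counit W).toLinearMap ∘ₗ G = (counit V).toLinearMap := LinearMap.ext hGε
    rw [conv_apply, h, map_add, TensorProduct.map_map, TensorProduct.map_map, hF', hG', map_add,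
      ← conv_apply, ← conv_apply] at h1
    have hε : (counit V).toLinearMap = (counit V).toLinearMap.smulRight (1 : k) := by
      ext; simp
    have h2 : conv (counit V).toLinearMap ((counit W).toLinearMap ∘ₗ P) x =
        counit W (P x) := by
      rw [hε, conv_counit_left, one_mul]; rfl
    have h3 : conv ((counit W).toLinearMap ∘ₗ P) (counit V).toLinearMap x =
        counit W (P x) := by
      rw [conv_apply, ← LinearMap.comp_id ((counit W).toLinearMap ∘ₗ P),
        ← LinearMap.id_comp (counit V).toLinearMap, TensorProduct.map_comp, LinearMap.comp_apply,
        counit_comul_right]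
      simp
    rw [h2, h3] at h1
    simpa using h1
  · intro x
    -- With `pr P = 0`, the term `P ⊗ F` contributes nothing to the Euler operator, leaving the
    -- convolution of `ι pr G` with `P`.
    have hP' : (ι W ∘ₗ proj W) ∘ₗ P = 0 := by
      ext x; simp [hP]
    rw [conv_apply, h, map_add, TensorProduct.map_map, TensorProduct.map_map, hP',
      TensorProduct.map_zero_left]
    simp [conv_apply]

end Sym

/-- The difference is skew: `f ⊗ f - g ⊗ g = (f - g) ⊗ f + g ⊗ (f - g)`. -/
theorem hom_ext_of_coeff [Algebra ℚ k] {V W : FormalSupermanifold.{u, v} k} {f g : V ⟶ W}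
    (h : ∀ x, coeff f x = coeff g x) : f = g := by
  have h1 : FormalMap.toLin f - FormalMap.toLin g = 0 := by
    apply Sym.eq_zero_of_skew (F := FormalMap.toLin f) (G := FormalMap.toLin g)
    · exact FormalMap.map_one g
    · exact FormalMap.counit_comp f
    · exact FormalMap.counit_comp g
    · intro x
      rw [LinearMap.sub_apply, map_sub, FormalMap.comul_comp f, FormalMap.comul_comp g]
      simp only [← TensorProduct.mapBilinear_apply, map_sub, LinearMap.sub_apply]
      abel
    · intro x
      rw [LinearMap.sub_apply, map_sub, sub_eq_zero]
      exact h x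
  exact FormalMap.ext (sub_eq_zero.mp h1)

namespace Sym

variable {V W : FormalSupermanifold.{u, v} k}

/-! ### Degrees of convolutions -/

/-- The part of linear degree `d` of `S(V) ⊗ S(V)`. -/
noncomputable def tensorDegree (V : FormalSupermanifold.{u, v} k) (d : ℤ) :
    Submodule k (Sym V ⊗[k] Sym V) :=
  Submodule.span k {t | ∃ i j : ℤ, i + j = d ∧ ∃ x ∈ degree V i, ∃ y ∈ degree V j, x ⊗ₜ y = t}

theorem comul_mem {d : ℤ} {x : Sym V} (hx : x ∈ degree V d) :
    comul V x ∈ tensorDegree V d := by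
  induction hx using Submodule.span_induction with
  | zero => simp
  | add _ _ _ _ h h' => rw [map_add]; exact add_mem h h'
  | smul r _ _ h => rw [map_smul]; exact Submodule.smul_mem _ r h
  | mem x hx =>
    obtain ⟨l, rfl, rfl⟩ := hx
    induction l with
    | nil =>
      rw [List.map_nil, List.map_nil, List.prod_nil, comul_one]
      exact Submodule.subset_span ⟨0, 0, by simp, 1, one_mem_degree, 1, one_mem_degree, rfl⟩
    | cons a l ih =>
      obtain ⟨i, a⟩ := a
      simp only [List.map_cons, List.prod_cons, List.sum_cons, comul_gen_mul]
      generalize comul V _ = t at ih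
      induction ih using Submodule.span_induction with
      | zero => simp
      | add _ _ _ _ h h' => rw [map_add]; exact add_mem h h'
      | smul r _ _ h => rw [map_smul]; exact Submodule.smul_mem _ r h
      | mem t ht =>
        obtain ⟨p, q, hpq, x, hx, y, hy, rfl⟩ := ht
        simp only [genAct, LinearMap.add_apply, TensorProduct.map_tmul, LinearMap.id_apply,
          LinearMap.mulLeft_apply, AlgHom.toLinearMap_apply]
        refine add_mem (Submodule.subset_span ⟨i + p, q, by rw [← hpq, add_assoc], _,
          SetLike.GradedMul.mul_mem (gen_mem V i a) hx, y, hy, rfl⟩)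
          (Submodule.subset_span ⟨p, i + q, by rw [← hpq]; ring, _, map_mem _ p x hx, _,
          SetLike.GradedMul.mul_mem (gen_mem V i a) hy, rfl⟩)

theorem conv_mem {φ ψ : Sym V →ₗ[k] Sym W} {p q : ℤ}
    (hφ : ∀ d, ∀ x ∈ degree V d, φ x ∈ degree W (d + p))
    (hψ : ∀ d, ∀ x ∈ degree V d, ψ x ∈ degree W (d + q)) (d : ℤ) (x : Sym V)
    (hx : x ∈ degree V d) : conv φ ψ x ∈ degree W (d + (p + q)) := by
  rw [conv_apply]
  have h := comul_mem hx
  generalize comul V x = t at h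
  induction h using Submodule.span_induction with
  | zero => simp
  | add _ _ _ _ h h' => rw [map_add, map_add]; exact add_mem h h'
  | smul r _ _ h => rw [map_smul, map_smul]; exact Submodule.smul_mem _ r h
  | mem t ht =>
    obtain ⟨i, j, rfl, x, hx, y, hy, rfl⟩ := ht
    rw [TensorProduct.map_tmul, LinearMap.mul'_apply,
      show i + j + (p + q) = (i + p) + (j + q) by ring]
    exact SetLike.GradedMul.mul_mem (hφ i x hx) (hψ j y hy)

theorem conv_counit_right {A : Type*} [Ring A] [Algebra k A] (φ : Sym V →ₗ[k] A) (a : A)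
    (x : Sym V) : conv φ ((counit V).toLinearMap.smulRight a) x = φ x * a := by
  have h : (counit V).toLinearMap.smulRight a =
      ((LinearMap.id : k →ₗ[k] k).smulRight a) ∘ₗ (counit V).toLinearMap := by
    ext; simp
  rw [conv_apply, h, ← LinearMap.comp_id φ, TensorProduct.map_comp, LinearMap.comp_apply,
    counit_comul_right]
  simp

/-! ### Coderivations from Taylor coefficients -/

theorem proj_ofCoeff (q : Sym V →ₗ[k] V.Total) (x : Sym V) : proj V (ofCoeff q x) = q x := by
  have h : proj V ∘ₗ LinearMap.mul' k (Sym V) ∘ₗ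
      TensorProduct.map (ι V ∘ₗ q) LinearMap.id =
      (TensorProduct.rid k _).toLinearMap ∘ₗ TensorProduct.map q LinearMap.id ∘ₗ
        TensorProduct.map LinearMap.id (counit V).toLinearMap := by
    apply TensorProduct.ext'
    intro y z
    simp [proj_ι_mul]
  have h' := LinearMap.congr_fun h (comul V x)
  simp only [LinearMap.comp_apply, counit_comul_right] at h'
  exact h'.trans (by simp)

/-- Since `q(y)` is primitive, `Δ(q(y) z)` has two terms: `q(y)` multiplies either the first or the
second factor of `Δ z`. Coassociativity identifies the first term with `(Q ⊗ 1) Δ`; the second also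
needs `y` to be exchanged with the first factor of `Δ z`, which cocommutativity permits. -/
theorem ofCoeff_isVectorField {q : Sym V →ₗ[k] V.Total}
    (hq : ∀ d, ∀ x ∈ degree V d, q x ∈ LinearMap.range (V.hom (d + 1))) :
    IsVectorField V (ofCoeff q) where
  map_degree d x hx := by
    have h := conv_mem (φ := ι V ∘ₗ q) (ψ := LinearMap.id) (p := 1) (q := 0) (by
      intro d x hx
      obtain ⟨a, ha⟩ := hq d x hx
      rw [LinearMap.comp_apply, ← ha, ι_hom]
      exact gen_mem _ _ _) (by
      intro d x hx
      rw [add_zero]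
      exact hx) d x hx
    rwa [add_zero] at h
  comul_comp x := by
    let m : Sym V ⊗[k] Sym V →ₗ[k] Sym V :=
      LinearMap.mul' k (Sym V) ∘ₗ TensorProduct.map (ι V ∘ₗ q) LinearMap.id
    let L : Sym V ⊗[k] (Sym V ⊗[k] Sym V) →ₗ[k] Sym V ⊗[k] Sym V :=
      TensorProduct.lift (gmul V ∘ₗ comul V ∘ₗ ι V ∘ₗ q)
    have h1 : comul V ∘ₗ m = L ∘ₗ TensorProduct.map LinearMap.id (comul V) := by
      apply TensorProduct.ext'
      intro y z
      simp [m, L, comul_mul]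
    -- As `q(y)` has degree `|y| + 1`, its passage across `z` costs `(-1)^{|z|}`, the operator
    -- `sign`, times `(-1)^{|y||z|}`, the sign of the twist.
    have h2 : L ∘ₗ (TensorProduct.assoc k _ _ _).toLinearMap =
        TensorProduct.map m LinearMap.id +
          TensorProduct.map (sign V).toLinearMap m ∘ₗ
            (TensorProduct.assoc k _ _ _).toLinearMap ∘ₗ
            TensorProduct.map (twist V) LinearMap.id := by
      apply TensorProduct.ext
      apply tensor_ext
      intro i y hy j z hz
      ext w
      obtain ⟨a, ha⟩ := hq i y hy
      simp only [LinearMap.compr₂ₛₗ_apply, TensorProduct.mk_apply, LinearMap.comp_apply,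
        LinearEquiv.coe_coe, TensorProduct.assoc_tmul, LinearMap.add_apply,
        TensorProduct.map_tmul, twist_tmul hy hz, LinearMap.id_apply, L, m,
        TensorProduct.lift.tmul, ← ha, ι_hom, gmul_comul_gen, genAct, LinearMap.mul'_apply,
        LinearMap.mulLeft_apply, AlgHom.toLinearMap_apply, units_smul_tmul,
        signBy_of_mem _ hz]
      congr 1
      rw [← LinearEquiv.coe_coe, map_units_smul, map_units_smul, LinearEquiv.coe_coe,
        TensorProduct.assoc_tmul, TensorProduct.map_tmul, AlgHom.toLinearMap_apply,
        sign_of_mem hz, units_smul_tmul, smul_smul, ← uzpow_add,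
        LinearMap.comp_apply, TensorProduct.map_tmul, LinearMap.mul'_apply, LinearMap.comp_apply,
        ← ha, ι_hom, LinearMap.id_apply]
      congr 2
      ring
    have h3 : TensorProduct.map (twist V) LinearMap.id ∘ₗ
        TensorProduct.map (comul V) LinearMap.id =
        TensorProduct.map (comul V) (LinearMap.id : Sym V →ₗ[k] Sym V) := by
      rw [← TensorProduct.map_comp, LinearMap.id_comp]
      congr 1
      exact LinearMap.ext twist_comul
    have hm : m ∘ₗ comul V = ofCoeff q := rfl
    have h1' := LinearMap.congr_fun h1 (comul V x)
    have h2' := LinearMap.congr_fun h2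
      (TensorProduct.map (comul V) LinearMap.id (comul V x))
    have h3' := LinearMap.congr_fun h3 (comul V x)
    simp only [LinearMap.comp_apply, LinearMap.add_apply, LinearEquiv.coe_coe] at h1' h2' h3'
    rw [h3', coassoc, TensorProduct.map_map, TensorProduct.map_map, hm, LinearMap.comp_id,
      LinearMap.comp_id] at h2'
    rw [← h2', ← h1']
    rfl

/-! ### The sum of two formal maps -/

/-- The bracketing on the right makes the two middle factors of the fourfold coproduct come from a
single `Δ`, so that cocommutativity can exchange them. -/
theorem comul_comul (x : Sym V) :
    TensorProduct.map (comul V) (comul V) (comul V x) =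
      (TensorProduct.assoc k _ _ _).symm (TensorProduct.map LinearMap.id
        ((TensorProduct.assoc k _ _ _).toLinearMap ∘ₗ
          TensorProduct.map (comul V) LinearMap.id ∘ₗ comul V) (comul V x)) := by
  have h1 : (TensorProduct.assoc k _ _ _).toLinearMap ∘ₗ
      TensorProduct.map (comul V) LinearMap.id ∘ₗ comul V =
      TensorProduct.map LinearMap.id (comul V) ∘ₗ comul V := LinearMap.ext coassoc
  have h2 : (TensorProduct.assoc k _ _ _).toLinearMap ∘ₗ
      TensorProduct.map LinearMap.id (comul V) =
      TensorProduct.map LinearMap.id (TensorProduct.map LinearMap.id (comul V)) ∘ₗ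
        (TensorProduct.assoc k (Sym V) (Sym V) (Sym V)).toLinearMap := by
    apply TensorProduct.ext_threefold
    intro x y z
    simp
  rw [LinearEquiv.eq_symm_apply, h1, ← LinearMap.comp_id LinearMap.id, TensorProduct.map_comp,
    LinearMap.comp_apply, ← coassoc]
  have h3 := LinearMap.congr_fun h2 (TensorProduct.map (comul V) LinearMap.id (comul V x))
  simp only [LinearMap.comp_apply, LinearEquiv.coe_coe] at h3
  rw [LinearMap.comp_id, ← h3, TensorProduct.map_map, LinearMap.id_comp, LinearMap.comp_id]

theorem counit_conv (φ ψ : Sym V →ₗ[k] Sym W) (hφ : ∀ x, counit W (φ x) = counit V x)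
    (hψ : ∀ x, counit W (ψ x) = counit V x) (x : Sym V) :
    counit W (conv φ ψ x) = counit V x := by
  have h : (counit W).toLinearMap ∘ₗ LinearMap.mul' k (Sym W) ∘ₗ TensorProduct.map φ ψ =
      LinearMap.mul' k k ∘ₗ TensorProduct.map (counit V).toLinearMap
        (counit V).toLinearMap := by
    apply TensorProduct.ext'
    intro y z
    simp [hφ, hψ]
  have h' := LinearMap.congr_fun h (comul V x)
  exact h'.trans (counit_mul_comul x)

end Sym

/-- The sum of two formal maps, as a convolution product of coalgebra maps. -/
noncomputable def FormalMap.add {V W : FormalSupermanifold.{u, v} k} (F G : FormalMap V W) :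
    FormalMap V W where
  toLin := Sym.conv F.toLin G.toLin
  map_one := by rw [Sym.conv_one, F.map_one, G.map_one, one_mul]
  map_degree d x hx := by
    have h := Sym.conv_mem (φ := F.toLin) (ψ := G.toLin) (p := 0) (q := 0)
      (fun d x h => by rw [add_zero]; exact F.map_degree d x h)
      (fun d x h => by rw [add_zero]; exact G.map_degree d x h) d x hx
    rwa [add_zero, add_zero] at h
  counit_comp := Sym.counit_conv _ _ F.counit_comp G.counit_comp
  comul_comp x := by
    let m : Sym V ⊗[k] Sym V →ₗ[k] Sym W :=
      LinearMap.mul' k (Sym W) ∘ₗ TensorProduct.map F.toLin G.toLin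
    let L : (Sym V ⊗[k] Sym V) ⊗[k] (Sym V ⊗[k] Sym V) →ₗ[k] Sym W ⊗[k] Sym W :=
      TensorProduct.lift (Sym.gmul W) ∘ₗ
        TensorProduct.map (TensorProduct.map F.toLin F.toLin)
          (TensorProduct.map G.toLin G.toLin)
    let e : Sym V ⊗[k] ((Sym V ⊗[k] Sym V) ⊗[k] Sym V) →ₗ[k]
        (Sym V ⊗[k] Sym V) ⊗[k] (Sym V ⊗[k] Sym V) :=
      (TensorProduct.assoc k _ _ _).symm.toLinearMap ∘ₗ
        TensorProduct.map LinearMap.id (TensorProduct.assoc k _ _ _).toLinearMap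
    have h1 : Sym.comul W ∘ₗ m = L ∘ₗ TensorProduct.map (Sym.comul V) (Sym.comul V) := by
      apply TensorProduct.ext'
      intro y z
      simp [m, L, Sym.comul_mul, F.comul_comp, G.comul_comp]
    -- The Koszul product interchanges the two middle factors. Its sign is that of the twist before
    -- `F` and `G` are applied, because both have degree `0`.
    have h2 : L ∘ₗ e = TensorProduct.map m m ∘ₗ e ∘ₗ
        TensorProduct.map LinearMap.id (TensorProduct.map (Sym.twist V) LinearMap.id) := by
      apply TensorProduct.ext
      ext1 y
      apply TensorProduct.ext
      apply Sym.tensor_ext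
      intro i z hz j w hw
      ext t
      simp only [LinearMap.compr₂ₛₗ_apply, TensorProduct.mk_apply, LinearMap.comp_apply, e,
        LinearEquiv.coe_coe, TensorProduct.map_tmul, LinearMap.id_apply,
        TensorProduct.assoc_tmul, TensorProduct.assoc_symm_tmul, L, TensorProduct.lift.tmul,
        Sym.gmul_tmul _ (F.map_degree i z hz) (G.map_degree j w hw), Sym.twist_tmul hz hw,
        Sym.units_smul_tmul, Sym.tmul_units_smul]
      rw [← LinearEquiv.coe_coe, Sym.map_units_smul, Sym.map_units_smul, Sym.map_units_smul]
      simp [m, mul_comm]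
    have h3 : ∀ y, e (TensorProduct.map LinearMap.id (TensorProduct.map (Sym.comul V)
        LinearMap.id ∘ₗ Sym.comul V) y) = (TensorProduct.assoc k _ _ _).symm
        (TensorProduct.map LinearMap.id ((TensorProduct.assoc k _ _ _).toLinearMap ∘ₗ
          TensorProduct.map (Sym.comul V) LinearMap.id ∘ₗ Sym.comul V) y) := by
      intro y
      simp only [e, LinearMap.comp_apply, LinearEquiv.coe_coe, TensorProduct.map_map,
        LinearMap.comp_id]
    have h4 : TensorProduct.map (Sym.twist V) LinearMap.id ∘ₗ
        TensorProduct.map (Sym.comul V) LinearMap.id ∘ₗ Sym.comul V =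
        TensorProduct.map (Sym.comul V) (LinearMap.id : Sym V →ₗ[k] Sym V) ∘ₗ
          Sym.comul V := by
      rw [← LinearMap.comp_assoc, ← TensorProduct.map_comp, LinearMap.id_comp]
      congr 2
      exact LinearMap.ext Sym.twist_comul
    have h1' := LinearMap.congr_fun h1 (Sym.comul V x)
    have h2' := LinearMap.congr_fun h2 (TensorProduct.map LinearMap.id
      (TensorProduct.map (Sym.comul V) LinearMap.id ∘ₗ Sym.comul V) (Sym.comul V x))
    simp only [LinearMap.comp_apply] at h1' h2'
    rw [TensorProduct.map_map, h4, LinearMap.comp_id, h3, ← Sym.comul_comul, ← h1',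
      TensorProduct.map_map] at h2'
    exact h2'

namespace Sym

variable {V W X : FormalSupermanifold.{u, v} k}

theorem map_map (φ : ∀ i, V.obj i →ₗ[k] W.obj i) (ψ : ∀ i, W.obj i →ₗ[k] X.obj i)
    (x : Sym V) : map ψ (map φ x) = map (fun i => ψ i ∘ₗ φ i) x := by
  have h : (map ψ).comp (map φ) = map (fun i => ψ i ∘ₗ φ i) := by
    apply algHom_ext
    intro i a
    simp
  exact DFunLike.congr_fun h x

theorem map_id (x : Sym V) : map (fun i => (LinearMap.id : V.obj i →ₗ[k] V.obj i)) x = x := by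
  have h : map (fun i => (LinearMap.id : V.obj i →ₗ[k] V.obj i)) = AlgHom.id k _ := by
    apply algHom_ext
    intro i a
    simp
  exact DFunLike.congr_fun h x

theorem map_zero_apply (x : Sym V) :
    map (fun i => (0 : V.obj i →ₗ[k] W.obj i)) x = counit V x • 1 := by
  have h : map (fun i => (0 : V.obj i →ₗ[k] W.obj i)) =
      (Algebra.ofId k (Sym W)).comp (counit V) := by
    apply algHom_ext
    intro i a
    simp
  rw [h, AlgHom.comp_apply, Algebra.ofId_apply, Algebra.algebraMap_eq_smul_one]

theorem map_signBy (φ : ∀ i, V.obj i →ₗ[k] W.obj i) (i : ℤ) (x : Sym V) :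
    map φ (signBy V i x) = signBy W i (map φ x) := by
  rw [signBy, map_map, signBy, map_map]
  congr 1
  congr 1
  funext j
  ext a
  simp

theorem map_conv {A C : Type*} [Ring A] [Algebra k A] [Ring C] [Algebra k C] (F : A →ₐ[k] C)
    (φ ψ : Sym V →ₗ[k] A) (x : Sym V) :
    F (conv φ ψ x) = conv (F.toLinearMap ∘ₗ φ) (F.toLinearMap ∘ₗ ψ) x := by
  refine LinearMap.congr_fun (?_ : F.toLinearMap ∘ₗ LinearMap.mul' k A ∘ₗ
    TensorProduct.map φ ψ = LinearMap.mul' k C ∘ₗ TensorProduct.map _ _) (comul V x)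
  apply TensorProduct.ext'
  intro y z
  simp

end Sym

theorem toLin_comp {V W X : FormalSupermanifold.{u, v} k} (f : V ⟶ W) (g : W ⟶ X)
    (x : Sym V) : FormalMap.toLin (f ≫ g) x = FormalMap.toLin g (FormalMap.toLin f x) := rfl

theorem toLin_sign {V W : FormalSupermanifold.{u, v} k} (f : V ⟶ W) (x : Sym V) :
    FormalMap.toLin f (Sym.sign V x) = Sym.sign W (FormalMap.toLin f x) := by
  refine LinearMap.congr_fun (?_ : FormalMap.toLin f ∘ₗ (Sym.sign V).toLinearMap =
    (Sym.sign W).toLinearMap ∘ₗ FormalMap.toLin f) x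
  apply Sym.hom_ext_degree
  intro d x hx
  simp only [LinearMap.comp_apply, AlgHom.toLinearMap_apply, Sym.sign_of_mem hx,
    Sym.sign_of_mem (FormalMap.map_degree f d x hx), Sym.map_units_smul]

/-! ### Products of formal supermanifolds -/

section Prod

variable {A B C X : FormalSupermanifold.{u, v} k}

theorem fst_inl (x : Sym A) :
    FormalMap.toLin (fst A B) (FormalMap.toLin (inl A B) x) = x :=
  (Sym.map_map _ _ x).trans (Sym.map_id x)

theorem snd_inr (x : Sym B) :
    FormalMap.toLin (snd A B) (FormalMap.toLin (inr A B) x) = x :=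
  (Sym.map_map _ _ x).trans (Sym.map_id x)

theorem fst_inr (x : Sym B) :
    FormalMap.toLin (fst A B) (FormalMap.toLin (inr A B) x) = Sym.counit B x • 1 :=
  (Sym.map_map _ _ x).trans (Sym.map_zero_apply x)

theorem snd_inl (x : Sym A) :
    FormalMap.toLin (snd A B) (FormalMap.toLin (inl A B) x) = Sym.counit A x • 1 :=
  (Sym.map_map _ _ x).trans (Sym.map_zero_apply x)

theorem proj_strict {V W : FormalSupermanifold.{u, v} k} (φ : ∀ i, V.obj i →ₗ[k] W.obj i)
    (x : Sym V) :
    Sym.proj W (FormalMap.toLin (strict φ) x) = DirectSum.lmap φ (Sym.proj V x) :=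
  Sym.proj_map φ x

variable (A B) in
/-- The linear projection `A × B → A`. -/
noncomputable def fstTotal : (A.prod B).Total →ₗ[k] A.Total :=
  DirectSum.lmap fun i => LinearMap.fst k (A.obj i) (B.obj i)

variable (A B) in
/-- The linear projection `A × B → B`. -/
noncomputable def sndTotal : (A.prod B).Total →ₗ[k] B.Total :=
  DirectSum.lmap fun i => LinearMap.snd k (A.obj i) (B.obj i)

theorem proj_fst (x : Sym (A.prod B)) :
    Sym.proj A (FormalMap.toLin (fst A B) x) = fstTotal A B (Sym.proj _ x) :=
  proj_strict _ x

theorem proj_snd (x : Sym (A.prod B)) :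
    Sym.proj B (FormalMap.toLin (snd A B) x) = sndTotal A B (Sym.proj _ x) :=
  proj_strict _ x

theorem prod_total_ext {v w : (A.prod B).Total} (h1 : fstTotal A B v = fstTotal A B w)
    (h2 : sndTotal A B v = sndTotal A B w) : v = w := by
  apply DFinsupp.ext
  intro i
  have h1' := DFunLike.congr_fun h1 i
  have h2' := DFunLike.congr_fun h2 i
  exact Prod.ext h1' h2'

theorem hom_ext_prod [Algebra ℚ k] {f g : X ⟶ A.prod B} (h1 : f ≫ fst A B = g ≫ fst A B)
    (h2 : f ≫ snd A B = g ≫ snd A B) : f = g := by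
  apply hom_ext_of_coeff
  intro x
  rw [coeff, coeff, LinearMap.comp_apply, LinearMap.comp_apply]
  apply prod_total_ext
  · rw [← proj_fst, ← proj_fst, ← toLin_comp, ← toLin_comp, h1]
  · rw [← proj_snd, ← proj_snd, ← toLin_comp, ← toLin_comp, h2]

/-- The formal map `X → A × B` with components `u` and `w`. -/
noncomputable def prodLift (u : X ⟶ A) (w : X ⟶ B) : X ⟶ A.prod B :=
  FormalMap.add (u ≫ inl A B) (w ≫ inr A B)

theorem toLin_prodLift (u : X ⟶ A) (w : X ⟶ B) :
    FormalMap.toLin (prodLift u w) =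
      Sym.conv (FormalMap.toLin (inl A B) ∘ₗ FormalMap.toLin u)
        (FormalMap.toLin (inr A B) ∘ₗ FormalMap.toLin w) := rfl

theorem toLin_ext {V W : FormalSupermanifold.{u, v} k} {f g : V ⟶ W}
    (h : ∀ x, FormalMap.toLin f x = FormalMap.toLin g x) : f = g :=
  FormalMap.ext (LinearMap.ext h)

theorem fst_conv (φ ψ : Sym X →ₗ[k] Sym (A.prod B)) (x : Sym X) :
    FormalMap.toLin (fst A B) (Sym.conv φ ψ x) =
      Sym.conv (FormalMap.toLin (fst A B) ∘ₗ φ) (FormalMap.toLin (fst A B) ∘ₗ ψ) x :=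
  Sym.map_conv _ φ ψ x

theorem snd_conv (φ ψ : Sym X →ₗ[k] Sym (A.prod B)) (x : Sym X) :
    FormalMap.toLin (snd A B) (Sym.conv φ ψ x) =
      Sym.conv (FormalMap.toLin (snd A B) ∘ₗ φ) (FormalMap.toLin (snd A B) ∘ₗ ψ) x :=
  Sym.map_conv _ φ ψ x

theorem prodLift_fst (u : X ⟶ A) (w : X ⟶ B) : prodLift u w ≫ fst A B = u := by
  apply toLin_ext
  intro x
  have h1 : FormalMap.toLin (fst A B) ∘ₗ FormalMap.toLin (inl A B) ∘ₗ FormalMap.toLin u =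
      FormalMap.toLin u := by
    apply LinearMap.ext
    intro x
    rw [LinearMap.comp_apply, LinearMap.comp_apply, fst_inl]
  have h2 : FormalMap.toLin (fst A B) ∘ₗ FormalMap.toLin (inr A B) ∘ₗ FormalMap.toLin w =
      (Sym.counit X).toLinearMap.smulRight 1 := by
    apply LinearMap.ext
    intro x
    rw [LinearMap.comp_apply, LinearMap.comp_apply, fst_inr, FormalMap.counit_comp w,
      LinearMap.smulRight_apply, AlgHom.toLinearMap_apply]
  rw [toLin_comp, toLin_prodLift, fst_conv, h1, h2, Sym.conv_counit_right, mul_one]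

theorem prodLift_snd (u : X ⟶ A) (w : X ⟶ B) : prodLift u w ≫ snd A B = w := by
  apply toLin_ext
  intro x
  have h1 : FormalMap.toLin (snd A B) ∘ₗ FormalMap.toLin (inr A B) ∘ₗ FormalMap.toLin w =
      FormalMap.toLin w := by
    apply LinearMap.ext
    intro x
    rw [LinearMap.comp_apply, LinearMap.comp_apply, snd_inr]
  have h2 : FormalMap.toLin (snd A B) ∘ₗ FormalMap.toLin (inl A B) ∘ₗ FormalMap.toLin u =
      (Sym.counit X).toLinearMap.smulRight 1 := by
    apply LinearMap.ext
    intro x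
    rw [LinearMap.comp_apply, LinearMap.comp_apply, snd_inl, FormalMap.counit_comp u,
      LinearMap.smulRight_apply, AlgHom.toLinearMap_apply]
  rw [toLin_comp, toLin_prodLift, snd_conv, h1, h2, Sym.conv_counit_left, one_mul]

theorem eq_zero_of_skew_prod [Algebra ℚ k] {P F G : Sym X →ₗ[k] Sym (A.prod B)}
    (hG : G 1 = 1) (hFε : ∀ x, Sym.counit _ (F x) = Sym.counit X x)
    (hGε : ∀ x, Sym.counit _ (G x) = Sym.counit X x)
    (h : ∀ x, Sym.comul _ (P x) = TensorProduct.map P F (Sym.comul X x) +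
      TensorProduct.map G P (Sym.comul X x))
    (h1 : ∀ x, FormalMap.toLin (fst A B) (P x) = 0)
    (h2 : ∀ x, FormalMap.toLin (snd A B) (P x) = 0) : P = 0 := by
  apply Sym.eq_zero_of_skew hG hFε hGε h
  intro x
  apply prod_total_ext
  · rw [← proj_fst, h1, map_zero, map_zero]
  · rw [← proj_snd, h2, map_zero, map_zero]

theorem strict_gen_mul {V W : FormalSupermanifold.{u, v} k} (φ : ∀ i, V.obj i →ₗ[k] W.obj i)
    (i : ℤ) (a : V.obj i) (x : Sym V) :
    FormalMap.toLin (strict φ) (Sym.gen V i a * x) =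
      Sym.gen W i (φ i a) * FormalMap.toLin (strict φ) x := by
  rw [← Sym.map_gen]
  exact map_mul (Sym.map φ) _ _

theorem inl_gen_mul (i : ℤ) (a : A.obj i) (x : Sym A) :
    FormalMap.toLin (inl A B) (Sym.gen A i a * x) =
      Sym.gen (A.prod B) i (a, 0) * FormalMap.toLin (inl A B) x :=
  strict_gen_mul _ i a x

theorem inr_gen_mul (i : ℤ) (b : B.obj i) (x : Sym B) :
    FormalMap.toLin (inr A B) (Sym.gen B i b * x) =
      Sym.gen (A.prod B) i (0, b) * FormalMap.toLin (inr A B) x :=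
  strict_gen_mul _ i b x

theorem fst_gen_mul (i : ℤ) (a : A.obj i) (b : B.obj i) (x : Sym (A.prod B)) :
    FormalMap.toLin (fst A B) (Sym.gen (A.prod B) i (a, b) * x) =
      Sym.gen A i a * FormalMap.toLin (fst A B) x :=
  strict_gen_mul _ i (a, b) x

theorem snd_gen_mul (i : ℤ) (a : A.obj i) (b : B.obj i) (x : Sym (A.prod B)) :
    FormalMap.toLin (snd A B) (Sym.gen (A.prod B) i (a, b) * x) =
      Sym.gen B i b * FormalMap.toLin (snd A B) x :=
  strict_gen_mul _ i (a, b) x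

/-- This inverts the multiplication `S(A) ⊗ S(B) → S(A × B)` from one side and makes convolutions of
maps that factor through the projections computable. In the induction, the summand where `(a, 0)`
lands in the second factor is killed by `snd`. -/
theorem fst_snd_comul (x : Sym A) (y : Sym B) :
    TensorProduct.map (FormalMap.toLin (fst A B)) (FormalMap.toLin (snd A B))
      (Sym.comul _ (FormalMap.toLin (inl A B) x * FormalMap.toLin (inr A B) y)) = x ⊗ₜ y := by
  refine LinearMap.congr_fun (?_ :
    TensorProduct.map (FormalMap.toLin (fst A B)) (FormalMap.toLin (snd A B)) ∘ₗ
      Sym.comul _ ∘ₗ LinearMap.mulRight k (FormalMap.toLin (inr A B) y) ∘ₗ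
        FormalMap.toLin (inl A B) = (TensorProduct.mk k _ _).flip y) x
  apply Sym.hom_ext_gen
  · have h1 : FormalMap.toLin (fst A B) ∘ₗ FormalMap.toLin (inr A B) =
        (LinearMap.id : k →ₗ[k] k).smulRight 1 ∘ₗ (Sym.counit B).toLinearMap := by
      ext y
      exact fst_inr y
    have h2 : FormalMap.toLin (snd A B) ∘ₗ FormalMap.toLin (inr A B) =
        LinearMap.id ∘ₗ LinearMap.id := by
      ext y
      exact snd_inr y
    simp only [LinearMap.comp_apply, FormalMap.map_one, LinearMap.mulRight_apply, one_mul,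
      FormalMap.comul_comp]
    rw [TensorProduct.map_map, h1, h2, TensorProduct.map_comp, LinearMap.comp_apply,
      Sym.counit_comul_left]
    simp
  · intro i a x ih
    have key : TensorProduct.map (FormalMap.toLin (fst A B)) (FormalMap.toLin (snd A B)) ∘ₗ
        Sym.genAct (V := A.prod B) i (a, 0) =
        TensorProduct.map (LinearMap.mulLeft k (Sym.gen A i a)) LinearMap.id ∘ₗ
          TensorProduct.map (FormalMap.toLin (fst A B)) (FormalMap.toLin (snd A B)) := by
      apply TensorProduct.ext'
      intro z w
      simp [Sym.genAct, fst_gen_mul, snd_gen_mul]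
    have key' := LinearMap.congr_fun key
    simp only [LinearMap.comp_apply] at ih key' ⊢
    rw [inl_gen_mul, LinearMap.mulRight_apply, mul_assoc, Sym.comul_gen_mul (V := A.prod B) i (a, 0),
      key',
      ← LinearMap.mulRight_apply (R := k), ih]
    simp

theorem prodLift_inl_mul_inr (f : A ⟶ C) (x : Sym A) (y : Sym B) :
    FormalMap.toLin (prodLift (fst A B ≫ f) (snd A B))
      (FormalMap.toLin (inl A B) x * FormalMap.toLin (inr A B) y) =
      FormalMap.toLin (inl C B) (FormalMap.toLin f x) * FormalMap.toLin (inr C B) y := by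
  have h : FormalMap.toLin (inl C B) ∘ₗ FormalMap.toLin (fst A B ≫ f) =
      (FormalMap.toLin (inl C B) ∘ₗ FormalMap.toLin f) ∘ₗ FormalMap.toLin (fst A B) := rfl
  rw [toLin_prodLift, Sym.conv_apply, h, TensorProduct.map_comp, LinearMap.comp_apply,
    fst_snd_comul]
  rfl

theorem hom_ext_inl_mul_inr {N : Type*} [AddCommMonoid N] [Module k N]
    {φ ψ : Sym (A.prod B) →ₗ[k] N}
    (h : ∀ l l', φ (FormalMap.toLin (inl A B) (Sym.mon l) *
      FormalMap.toLin (inr A B) (Sym.mon l')) =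
      ψ (FormalMap.toLin (inl A B) (Sym.mon l) * FormalMap.toLin (inr A B) (Sym.mon l'))) :
    φ = ψ := by
  have h' : ∀ x y, φ (FormalMap.toLin (inl A B) x * FormalMap.toLin (inr A B) y) =
      ψ (FormalMap.toLin (inl A B) x * FormalMap.toLin (inr A B) y) := by
    intro x y
    refine LinearMap.congr_fun (?_ : φ ∘ₗ LinearMap.mulRight k _ ∘ₗ FormalMap.toLin (inl A B) =
      ψ ∘ₗ LinearMap.mulRight k _ ∘ₗ FormalMap.toLin (inl A B)) x
    apply Sym.hom_ext_mon
    intro l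
    refine LinearMap.congr_fun (?_ : φ ∘ₗ LinearMap.mulLeft k _ ∘ₗ FormalMap.toLin (inr A B) =
      ψ ∘ₗ LinearMap.mulLeft k _ ∘ₗ FormalMap.toLin (inr A B)) y
    exact Sym.hom_ext_mon (h l)
  -- The span `S` of the products is everything, since it contains `1` and is stable under
  -- generators: `(a, 0)` is absorbed by the left factor, and `(0, b)` is first moved across it by
  -- means of `signBy`.
  let S : Submodule k (Sym (A.prod B)) := Submodule.span k
    {z | ∃ x y, FormalMap.toLin (inl A B) x * FormalMap.toLin (inr A B) y = z}
  have hS : ∀ l, Sym.mon l ∈ S := by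
    intro l
    induction l with
    | nil =>
      refine Submodule.subset_span ⟨1, 1, ?_⟩
      rw [FormalMap.map_one, FormalMap.map_one, one_mul]
      rfl
    | cons c l ih =>
      obtain ⟨i, a, b⟩ := c
      rw [Sym.mon_cons]
      generalize Sym.mon l = z at ih
      induction ih using Submodule.span_induction with
      | zero => simp
      | add _ _ _ _ h h' => rw [mul_add]; exact add_mem h h'
      | smul r _ _ h => rw [mul_smul_comm]; exact Submodule.smul_mem _ r h
      | mem z hz =>
        obtain ⟨x, y, rfl⟩ := hz
        have hab : Sym.gen (A.prod B) i (a, b) =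
            Sym.gen (A.prod B) i (a, 0) + Sym.gen (A.prod B) i (0, b) :=
          (congrArg (Sym.gen (A.prod B) i) (Prod.ext (add_zero a).symm (zero_add b).symm)).trans
            (map_add (Sym.gen (A.prod B) i) (a, 0) (0, b))
        have h3 : FormalMap.toLin (inl A B) (Sym.signBy A i x) =
            Sym.signBy (A.prod B) i (FormalMap.toLin (inl A B) x) := Sym.map_signBy _ i x
        rw [hab, add_mul, ← mul_assoc, ← mul_assoc, ← inl_gen_mul,
          Sym.gen_mul_eq (V := A.prod B) i (0, b), ← h3,
          mul_assoc, ← inr_gen_mul]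
        exact add_mem (Submodule.subset_span ⟨_, _, rfl⟩) (Submodule.subset_span ⟨_, _, rfl⟩)
  apply Sym.hom_ext_mon
  intro l
  have hl := hS l
  generalize Sym.mon l = z at hl
  induction hl using Submodule.span_induction with
  | zero => simp
  | add _ _ _ _ h h' => rw [map_add, map_add, h, h']
  | smul r _ _ h => rw [map_smul, map_smul, h]
  | mem z hz =>
    obtain ⟨x, y, rfl⟩ := hz
    exact h' x y

end Prod

/-! ### Sums over permutations -/

/-- The sign of moving the entry `p` to the front. -/
def frontSign {n : ℕ} (d : Fin (n + 1) → ℤ) (p : Fin (n + 1)) : ℤˣ :=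
  ∏ j, if p.succAbove j < p then (-1 : ℤˣ) ^ (d p * d (p.succAbove j)) else 1

theorem frontSign_zero {n : ℕ} (d : Fin (n + 1) → ℤ) : frontSign d 0 = 1 := by
  simp [frontSign]

theorem frontSign_succ {n : ℕ} (d : Fin (n + 2) → ℤ) (p : Fin (n + 1)) :
    frontSign d p.succ = (-1 : ℤˣ) ^ (d p.succ * d 0) * frontSign (d ∘ Fin.succ) p := by
  rw [frontSign, Fin.prod_univ_succ, frontSign]
  simp [Fin.succ_succAbove_succ]

/-- The permutation with `0 ↦ p` which is given by `σ` on the other entries. -/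
noncomputable def consPerm {n : ℕ} (p : Fin (n + 1)) (σ : Equiv.Perm (Fin n)) :
    Equiv.Perm (Fin (n + 1)) :=
  Equiv.ofBijective (Fin.cons p (p.succAbove ∘ σ)) (Finite.injective_iff_bijective.mp
    (Fin.cons_injective_iff.mpr
      ⟨by rintro ⟨j, hj⟩; exact Fin.succAbove_ne p _ hj,
        (Fin.succAbove_right_injective).comp σ.injective⟩))

@[simp] theorem consPerm_zero {n : ℕ} (p : Fin (n + 1)) (σ : Equiv.Perm (Fin n)) :
    consPerm p σ 0 = p := rfl

@[simp] theorem consPerm_succ {n : ℕ} (p : Fin (n + 1)) (σ : Equiv.Perm (Fin n)) (j : Fin n) :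
    consPerm p σ j.succ = p.succAbove (σ j) := rfl

theorem consPerm_bijective (n : ℕ) :
    Function.Bijective fun q : Fin (n + 1) × Equiv.Perm (Fin n) => consPerm q.1 q.2 := by
  rw [Fintype.bijective_iff_injective_and_card]
  constructor
  · rintro ⟨p, σ⟩ ⟨q, τ⟩ h
    have hp : p = q := DFunLike.congr_fun h 0
    subst hp
    refine Prod.ext rfl (Equiv.ext fun j => ?_)
    exact Fin.succAbove_right_injective (DFunLike.congr_fun h j.succ)
  · rw [Fintype.card_prod, Fintype.card_perm, Fintype.card_perm, Fintype.card_fin,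
      Fintype.card_fin, Nat.factorial_succ]

/-- Inversions at position `0` are the entries below `p` and give `frontSign`; the others are the
inversions of `σ`, as `succAbove` is increasing. -/
theorem koszulSign_consPerm {n : ℕ} (d : Fin (n + 1) → ℤ) (p : Fin (n + 1))
    (σ : Equiv.Perm (Fin n)) :
    koszulSign d (consPerm p σ) = frontSign d p * koszulSign (d ∘ p.succAbove) σ := by
  rw [koszulSign, Fin.prod_univ_succ]
  congr 1
  · rw [Fin.prod_univ_succ, frontSign]
    refine Eq.trans ?_ (Equiv.prod_comp σ fun j =>
      if p.succAbove j < p then (-1 : ℤˣ) ^ (d p * d (p.succAbove j)) else 1)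
    simp
  · rw [koszulSign]
    apply Finset.prod_congr rfl
    intro i _
    rw [Fin.prod_univ_succ]
    simp [Fin.succAbove_lt_succAbove_iff]

namespace Sym

variable {V : FormalSupermanifold.{u, v} k}

/-- The signed sum of the values of `G` at all permutations of `x`. -/
def symSum {N : Type*} [AddCommGroup N] {n : ℕ} (G : List (Σ i, V.obj i) → N)
    (x : Fin n → Σ i, V.obj i) : N :=
  ∑ σ : Equiv.Perm (Fin n), koszulSign (fun i => (x i).1) σ • G (List.ofFn (x ∘ σ))

theorem symSum_succ {N : Type*} [AddCommGroup N] {n : ℕ} (G : List (Σ i, V.obj i) → N)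
    (x : Fin (n + 1) → Σ i, V.obj i) :
    symSum G x = ∑ p, frontSign (fun i => (x i).1) p •
      symSum (fun l => G (x p :: l)) (x ∘ p.succAbove) := by
  simp only [symSum, Finset.smul_sum]
  rw [← Fintype.sum_prod_type' (f := fun p σ => frontSign (fun i => (x i).1) p •
    koszulSign (fun i => ((x ∘ p.succAbove) i).1) σ •
      G (x p :: List.ofFn ((x ∘ p.succAbove) ∘ σ)))]
  symm
  apply Fintype.sum_bijective _ (consPerm_bijective n)
  rintro ⟨p, σ⟩
  rw [koszulSign_consPerm, mul_smul, List.ofFn_succ]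
  rfl

/-- The signs agree with those of `symSum_succ`; this is the bridge from sums over permutations to
the comultiplication. -/
theorem proj_comul_mon {n : ℕ} (x : Fin (n + 1) → Σ i, V.obj i) :
    TensorProduct.map (proj V) LinearMap.id (comul V (mon (List.ofFn x))) =
      ∑ p, frontSign (fun i => (x i).1) p •
        (V.hom _ (x p).2 ⊗ₜ[k] mon (List.ofFn (x ∘ p.succAbove))) := by
  have key : ∀ (i : ℤ) (a : V.obj i) (y : Sym V),
      TensorProduct.map (proj V) LinearMap.id (comul V (gen V i a * y)) =
        V.hom i a ⊗ₜ y + TensorProduct.map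
          (DirectSum.lmap fun j => (((-1 : ℤˣ) ^ (i * j) : ℤˣ) : ℤ) •
            (LinearMap.id : V.obj j →ₗ[k] V.obj j))
          (LinearMap.mulLeft k (gen V i a))
          (TensorProduct.map (proj V) LinearMap.id (comul V y)) := by
    intro i a y
    rw [comul_gen_mul, genAct, LinearMap.add_apply, map_add]
    congr 1
    · have h : TensorProduct.map (proj V) LinearMap.id ∘ₗ
          TensorProduct.map (LinearMap.mulLeft k (gen V i a)) LinearMap.id =
          TensorProduct.map ((LinearMap.id : k →ₗ[k] k).smulRight (V.hom i a)) LinearMap.id ∘ₗ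
            TensorProduct.map (counit V).toLinearMap (LinearMap.id : Sym V →ₗ[k] Sym V) := by
        apply TensorProduct.ext'
        intro z w
        simp [proj_gen_mul]
      have h' := LinearMap.congr_fun h (comul V y)
      rw [LinearMap.comp_apply, LinearMap.comp_apply, counit_comul_left] at h'
      rw [h']
      simp
    · rw [TensorProduct.map_map, TensorProduct.map_map]
      congr 2
      exact LinearMap.ext (proj_map _)
  induction n with
  | zero =>
    rw [List.ofFn_succ, mon_cons, key]
    simp [frontSign_zero]
  | succ n ih =>
    rw [List.ofFn_succ, mon_cons, key]
    have ih' := ih (fun i => x i.succ)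
    rw [ih', map_sum, Fin.sum_univ_succ (n := n + 1), frontSign_zero, one_smul]
    congr 1
    apply Finset.sum_congr rfl
    intro p _
    rw [map_units_smul, TensorProduct.map_tmul, lmap_hom, LinearMap.smul_apply, map_zsmul,
      ← Units.smul_def, units_smul_tmul, smul_smul, frontSign_succ, List.ofFn_succ, mon_cons,
      mul_comm, mul_comm (x 0).1]
    simp only [Function.comp_apply, Fin.succ_succAbove_succ]
    rfl

/-! ### Symmetrised block products as convolutions -/

section Split

variable {A : Type*} [Ring A] [Algebra k A]

theorem conv_nsmul_left (n : ℕ) (φ ψ : Sym V →ₗ[k] A) : conv (n • φ) ψ = n • conv φ ψ := by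
  ext y
  rw [conv_apply, ← TensorProduct.mapBilinear_apply, map_nsmul, LinearMap.smul_apply,
    LinearMap.smul_apply, map_nsmul, TensorProduct.mapBilinear_apply]
  rfl

theorem conv_nsmul_right (n : ℕ) (φ ψ : Sym V →ₗ[k] A) : conv φ (n • ψ) = n • conv φ ψ := by
  ext y
  rw [conv_apply, ← TensorProduct.mapBilinear_apply, map_nsmul, LinearMap.smul_apply, map_nsmul,
    TensorProduct.mapBilinear_apply]
  rfl

/-- Splitting off one letter and then `i` more is, by coassociativity, splitting off `i + 1`
letters, with each choice counted `i + 1` times by `conv_proj_polyPart`. This supplies the inductive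
step for `symSum_take_drop`. -/
theorem conv_assoc_tensor (φ : Sym V →ₗ[k] A) (H : Sym V →ₗ[k] A) (i : ℕ) :
    ∃ B : V.Total ⊗[k] Sym V →ₗ[k] A,
      (∀ v z, B (v ⊗ₜ z) =
        conv ((φ ∘ₗ LinearMap.mulLeft k (ι V v)) ∘ₗ polyPart V i) H z) ∧
      ∀ y, B (TensorProduct.map (proj V) LinearMap.id (comul V y)) =
        (i + 1) • conv (φ ∘ₗ polyPart V (i + 1)) H y := by
  let R : V.Total ⊗[k] (Sym V ⊗[k] Sym V) →ₗ[k] A :=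
    LinearMap.mul' k A ∘ₗ TensorProduct.map
      (φ ∘ₗ LinearMap.mul' k (Sym V) ∘ₗ TensorProduct.map (ι V) (polyPart V i)) H ∘ₗ
      (TensorProduct.assoc k _ _ _).symm.toLinearMap
  refine ⟨R ∘ₗ TensorProduct.map LinearMap.id (comul V), ?_, ?_⟩
  · intro v z
    rw [LinearMap.comp_apply, TensorProduct.map_tmul, LinearMap.id_apply]
    refine LinearMap.congr_fun (?_ : R ∘ₗ TensorProduct.mk k _ _ v =
      LinearMap.mul' k A ∘ₗ TensorProduct.map _ _) (comul V z)
    apply TensorProduct.ext'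
    intro y w
    simp [R]
  · intro y
    have h1 : R ∘ₗ TensorProduct.map (proj V) LinearMap.id ∘ₗ
        (TensorProduct.assoc k _ _ _).toLinearMap =
        LinearMap.mul' k A ∘ₗ TensorProduct.map (φ ∘ₗ LinearMap.mul' k (Sym V) ∘ₗ
          TensorProduct.map (ι V ∘ₗ proj V) (polyPart V i)) H := by
      apply TensorProduct.ext_threefold
      intro y z w
      simp [R]
    have h2 : (LinearMap.mul' k (Sym V) ∘ₗ
        TensorProduct.map (ι V ∘ₗ proj V) (polyPart V i)) ∘ₗ comul V =
        (i + 1) • polyPart V (i + 1) := by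
      ext z
      exact conv_proj_polyPart i z
    have h1' := LinearMap.congr_fun h1
      (TensorProduct.map (comul V) LinearMap.id (comul V y))
    simp only [LinearMap.comp_apply, LinearEquiv.coe_coe] at h1'
    rw [coassoc, TensorProduct.map_map, TensorProduct.map_map, LinearMap.comp_id,
      LinearMap.id_comp, LinearMap.comp_id, LinearMap.comp_assoc, h2] at h1'
    rw [LinearMap.comp_apply, TensorProduct.map_map, LinearMap.id_comp, LinearMap.comp_id, h1',
      conv_apply]
    have h3 : φ ∘ₗ ((i + 1) • polyPart V (i + 1)) = (i + 1) • (φ ∘ₗ polyPart V (i + 1)) := by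
      ext z
      rw [LinearMap.comp_apply, LinearMap.smul_apply, map_nsmul, LinearMap.smul_apply,
        LinearMap.comp_apply]
    rw [h3, ← conv_apply, conv_nsmul_left, LinearMap.smul_apply]
    rfl

/-- The comultiplication sums over shuffles, and each shuffle is hit by `i!` orderings of the first
block. The induction removes the leading letter and absorbs it into `φ` as a left multiplication. -/
theorem symSum_take_drop {h : List (Σ i, V.obj i) → A} {H : Sym V →ₗ[k] A} {m : ℕ}
    (hH : ∀ x : Fin m → Σ i, V.obj i, symSum h x = H (mon (List.ofFn x))) (i : ℕ)
    (φ : Sym V →ₗ[k] A) {n : ℕ} (hn : n = i + m) (x : Fin n → Σ i, V.obj i) :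
    symSum (fun l => φ (mon (l.take i)) * h (l.drop i)) x =
      i.factorial • conv (φ ∘ₗ polyPart V i) H (mon (List.ofFn x)) := by
  induction i generalizing φ n with
  | zero =>
    obtain rfl : n = m := by omega
    have h1 : φ ∘ₗ polyPart V 0 = (counit V).toLinearMap.smulRight (φ 1) := by
      ext y
      simp [polyPart_zero]
    rw [h1, conv_counit_left, ← hH]
    simp [symSum, Finset.mul_sum, mul_smul_comm]
  | succ i ih =>
    obtain rfl : n = (i + m) + 1 := by omega
    obtain ⟨B, hB1, hB2⟩ := conv_assoc_tensor φ H i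
    rw [symSum_succ]
    have h1 : ∀ p, symSum (fun l => φ (mon ((x p :: l).take (i + 1))) *
        h ((x p :: l).drop (i + 1))) (x ∘ p.succAbove) =
        i.factorial • B (V.hom _ (x p).2 ⊗ₜ mon (List.ofFn (x ∘ p.succAbove))) := by
      intro p
      rw [hB1, ← ih _ rfl]
      simp [ι_hom]
    simp only [h1]
    rw [Nat.factorial_succ, mul_comm, mul_smul, ← hB2, proj_comul_mon, map_sum, Finset.smul_sum]
    apply Finset.sum_congr rfl
    intro p _
    rw [map_units_smul, smul_comm]

/-- The product of the values of `φ` at the consecutive blocks of a list. -/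
noncomputable def blockProd (φ : Sym V →ₗ[k] A) : List ℕ → List (Σ i, V.obj i) → A
  | [], _ => 1
  | i :: bs, l => φ (mon (l.take i)) * blockProd φ bs (l.drop i)

/-- The convolution product of the components of `φ` of the given polynomial degrees. -/
noncomputable def convProd (φ : Sym V →ₗ[k] A) : List ℕ → (Sym V →ₗ[k] A)
  | [] => (counit V).toLinearMap.smulRight 1
  | i :: bs => conv (φ ∘ₗ polyPart V i) (convProd φ bs)

theorem symSum_blockProd (φ : Sym V →ₗ[k] A) (bs : List ℕ) {n : ℕ} (hn : n = bs.sum)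
    (x : Fin n → Σ i, V.obj i) :
    symSum (blockProd φ bs) x =
      (bs.map Nat.factorial).prod • convProd φ bs (mon (List.ofFn x)) := by
  induction bs generalizing n with
  | nil =>
    obtain rfl : n = 0 := by simpa using hn
    simp [symSum, blockProd, convProd, koszulSign]
  | cons i bs ih =>
    have h : ∀ y : Fin bs.sum → Σ i, V.obj i, symSum (blockProd φ bs) y =
        ((bs.map Nat.factorial).prod • convProd φ bs) (mon (List.ofFn y)) := ih rfl
    rw [convProd, List.map_cons, List.prod_cons, mul_smul]
    refine (symSum_take_drop h i φ (by simpa using hn) x).trans ?_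
    rw [conv_nsmul_right, LinearMap.smul_apply]

theorem blockProd_eq (φ : Sym V →ₗ[k] A) (bs : List ℕ) (l : List (Σ i, V.obj i)) :
    blockProd φ bs l = ((l.splitWrtCompositionAux bs).map fun s => φ (mon s)).prod := by
  induction bs generalizing l with
  | nil => simp [blockProd, List.splitWrtCompositionAux]
  | cons i bs ih =>
    rw [blockProd, ih, List.splitWrtCompositionAux_cons, List.map_cons, List.prod_cons]

end Split

end Sym

/-- Matches the indexing by `I.embedding` in `multiCoeff` with the recursive cutting of lists in
`blockProd`. -/
theorem ofFn_splitWrtComposition {α : Type*} {n : ℕ} (I : Composition n) (y : Fin n → α) :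
    (List.ofFn y).splitWrtComposition I =
      List.ofFn fun j => List.ofFn fun a => y (I.embedding j a) := by
  apply List.ext_getElem
  · simp
  · intro i h1 h2
    have hi : i < I.length := by simpa using h2
    rw [List.getElem_splitWrtComposition', List.getElem_ofFn]
    apply List.ext_getElem
    · have := I.sizeUpTo_succ hi
      have h3 := I.sizeUpTo_le (i + 1)
      simp [Composition.blocksFun]
      omega
    · intro j h3 h4
      simp [Composition.embedding]

/-- The composition `(i + 1, I)`. -/
def consComposition {n m : ℕ} (i : ℕ) (I : Composition n) (h : i + n + 1 = m) :
    Composition m where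
  blocks := (i + 1) :: I.blocks
  blocks_pos := by
    intro j hj
    rcases List.mem_cons.mp hj with rfl | hj
    · omega
    · exact I.blocks_pos hj
  blocks_sum := by
    rw [List.sum_cons, I.blocks_sum]
    omega

theorem sum_composition_zero {N : Type*} [AddCommMonoid N] (g : List ℕ → N) :
    ∑ I : Composition 0, g I.blocks = g [] := by
  have h : ∀ I : Composition 0, I.blocks = [] := by
    intro I
    rcases hI : I.blocks with _ | ⟨i, bs⟩
    · rfl
    · have h1 : 0 < i := I.blocks_pos (by rw [hI]; exact List.mem_cons_self)
      have h2 := I.blocks_sum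
      rw [hI, List.sum_cons] at h2
      omega
  exact Fintype.sum_eq_single (⟨[], by simp, rfl⟩ : Composition 0)
    fun I hI => absurd (Composition.ext (h I)) hI

/-- A composition of a positive number is its first block followed by a composition of the rest.
Blocks are positive, hence the shift `p.1 + 1` over the antidiagonal of `n`. -/
theorem sum_composition_succ {N : Type*} [AddCommMonoid N] (n : ℕ) (g : List ℕ → N) :
    ∑ I : Composition (n + 1), g I.blocks =
      ∑ p ∈ Finset.HasAntidiagonal.antidiagonal n, ∑ I : Composition p.2,
        g ((p.1 + 1) :: I.blocks) := by
  rw [Finset.sum_sigma']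
  symm
  refine Finset.sum_bij (fun q hq => consComposition q.1.1 q.2 (by
    have := Finset.HasAntidiagonal.mem_antidiagonal.mp (Finset.mem_sigma.mp hq).1
    omega)) (fun _ _ => Finset.mem_univ _) ?_ ?_ (fun _ _ => rfl)
  · rintro ⟨⟨a, b⟩, I⟩ h1 ⟨⟨c, d⟩, J⟩ h2 h
    have hb := congrArg Composition.blocks h
    simp only [consComposition, List.cons.injEq, Nat.add_right_cancel_iff] at hb
    obtain ⟨rfl, hb⟩ := hb
    obtain rfl : b = d := I.blocks_sum.symm.trans ((congrArg List.sum hb).trans J.blocks_sum)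
    rw [Composition.ext hb]
  · intro I _
    have hs := I.blocks_sum
    have hp : ∀ j ∈ I.blocks, 0 < j := fun j hj => I.blocks_pos hj
    rcases hI : I.blocks with _ | ⟨i, bs⟩
    · rw [hI] at hs
      simp at hs
    · rw [hI] at hs hp
      obtain ⟨i, rfl⟩ : ∃ j, i = j + 1 :=
        ⟨i - 1, by have := hp i List.mem_cons_self; omega⟩
      refine ⟨⟨(i, bs.sum), ⟨bs, fun hj => hp _ (List.mem_cons_of_mem _ hj), rfl⟩⟩, ?_, ?_⟩
      · rw [Finset.mem_sigma]
        refine ⟨Finset.HasAntidiagonal.mem_antidiagonal.mpr ?_, Finset.mem_univ _⟩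
        rw [List.sum_cons] at hs
        simp only
        omega
      · apply Composition.ext
        rw [hI]
        rfl

namespace Sym

variable {V W : FormalSupermanifold.{u, v} k}

theorem euler_ι_mul (v : V.Total) (y : Sym V) :
    conv (ι V ∘ₗ proj V) LinearMap.id (ι V v * y) =
      ι V v * y + ι V v * conv (ι V ∘ₗ proj V) LinearMap.id y := by
  refine LinearMap.congr_fun (?_ : conv (ι V ∘ₗ proj V) LinearMap.id ∘ₗ
    LinearMap.mulRight k y ∘ₗ ι V = LinearMap.mulRight k y ∘ₗ ι V +
      LinearMap.mulRight k (conv (ι V ∘ₗ proj V) LinearMap.id y) ∘ₗ ι V) v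
  apply DirectSum.linearMap_ext
  intro i
  ext a
  change conv (ι V ∘ₗ proj V) LinearMap.id (gen V i a * y) =
    gen V i a * y + gen V i a * conv (ι V ∘ₗ proj V) LinearMap.id y
  have h1 : (ι V ∘ₗ proj V) ∘ₗ LinearMap.mulLeft k (gen V i a) =
      (counit V).toLinearMap.smulRight (gen V i a) := by
    ext x
    simp [proj_gen_mul, ι_hom]
  rw [conv_gen_mul, h1, conv_counit_left, LinearMap.id_comp, ← LinearMap.comp_id
    (LinearMap.mulLeft k (gen V i a)), conv_mulLeft _ _ _ _ (ι_proj_signBy i),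
    LinearMap.id_apply]

theorem euler_conv (c : Sym V →ₗ[k] W.Total) (H : Sym V →ₗ[k] Sym W) :
    conv (ι W ∘ₗ proj W) LinearMap.id ∘ₗ conv (ι W ∘ₗ c) H =
      conv (ι W ∘ₗ c) H +
        conv (ι W ∘ₗ c) (conv (ι W ∘ₗ proj W) LinearMap.id ∘ₗ H) := by
  ext x
  refine LinearMap.congr_fun (?_ : conv (ι W ∘ₗ proj W) LinearMap.id ∘ₗ
    LinearMap.mul' k (Sym W) ∘ₗ TensorProduct.map (ι W ∘ₗ c) H =
      LinearMap.mul' k (Sym W) ∘ₗ TensorProduct.map (ι W ∘ₗ c) H +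
      LinearMap.mul' k (Sym W) ∘ₗ TensorProduct.map (ι W ∘ₗ c)
        (conv (ι W ∘ₗ proj W) LinearMap.id ∘ₗ H)) (comul V x)
  apply TensorProduct.ext'
  intro y z
  exact euler_ι_mul (c y) (H z)

/-- Each block contributes one factor in `W`, so the values have polynomial degree equal to the
number of blocks. -/
theorem euler_convProd (c : Sym V →ₗ[k] W.Total) (bs : List ℕ) :
    conv (ι W ∘ₗ proj W) LinearMap.id ∘ₗ convProd (ι W ∘ₗ c) bs =
      bs.length • convProd (ι W ∘ₗ c) bs := by
  induction bs with
  | nil =>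
    ext x
    simp [convProd, conv_one]
  | cons i bs ih =>
    rw [convProd, LinearMap.comp_assoc, euler_conv, ih, conv_nsmul_right, List.length_cons,
      add_smul, one_smul, add_comm]

theorem counit_convProd (c : Sym V →ₗ[k] W.Total) (i : ℕ) (bs : List ℕ) (x : Sym V) :
    counit W (convProd (ι W ∘ₗ c) (i :: bs) x) = 0 := by
  have h : (counit W).toLinearMap ∘ₗ (ι W ∘ₗ c) ∘ₗ polyPart V i = 0 := by
    ext y
    simp
  rw [convProd, map_conv, h, conv_zero_left, LinearMap.zero_apply]

end Sym

/-! ### A formal map as the sum of its components `f_I` -/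

section Expansion

variable {V W : FormalSupermanifold.{u, v} k}

theorem conv_smul_right {A : Type*} [Ring A] [Algebra k A] (c : k) (φ ψ : Sym V →ₗ[k] A) :
    Sym.conv φ (c • ψ) = c • Sym.conv φ ψ := by
  ext x
  rw [Sym.conv_apply, TensorProduct.map_smul_right, LinearMap.smul_apply, map_smul]
  rfl

theorem euler_toLin (f : V ⟶ W) (x : Sym V) :
    Sym.conv (Sym.ι W ∘ₗ Sym.proj W) LinearMap.id (FormalMap.toLin f x) =
      Sym.conv (Sym.ι W ∘ₗ coeff f) (FormalMap.toLin f) x := by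
  rw [Sym.conv_apply, FormalMap.comul_comp, TensorProduct.map_map]
  rfl

theorem coeff_one (f : V ⟶ W) : coeff f 1 = 0 := by
  rw [coeff, LinearMap.comp_apply, FormalMap.map_one, Sym.proj_one]

variable [Algebra ℚ k]

/-- The sum over all compositions of `r` in the expansion of a formal map. -/
noncomputable def expansion (f : V ⟶ W) (r : ℕ) : Sym V →ₗ[k] Sym W :=
  ∑ I : Composition r, algebraMap ℚ k (I.length.factorial : ℚ)⁻¹ •
    Sym.convProd (Sym.ι W ∘ₗ coeff f) I.blocks

theorem length_smul_inv_factorial {N : Type*} [AddCommGroup N] [Module k N] (n : ℕ) (x : N) :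
    algebraMap ℚ k ((n + 1).factorial : ℚ)⁻¹ • (n + 1) • x =
      algebraMap ℚ k (n.factorial : ℚ)⁻¹ • x := by
  rw [← Nat.cast_smul_eq_nsmul k, smul_smul, ← map_natCast (algebraMap ℚ k), ← map_mul]
  congr 2
  have h1 : ((n + 1 : ℕ) : ℚ) ≠ 0 := Nat.cast_ne_zero.mpr (Nat.succ_ne_zero n)
  have h2 : (n.factorial : ℚ) ≠ 0 := Nat.cast_ne_zero.mpr (Nat.factorial_ne_zero n)
  rw [Nat.factorial_succ, Nat.cast_mul]
  field_simp

/-- The Euler operator turns `1/t!` into `1/(t-1)!`, the weight of the composition without its first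
block. The result is the recursion that `euler_toLin` gives for `f` itself. -/
theorem euler_expansion (f : V ⟶ W) (r : ℕ) (x : Sym V) :
    Sym.conv (Sym.ι W ∘ₗ Sym.proj W) LinearMap.id (expansion f (r + 1) x) =
      ∑ p ∈ Finset.HasAntidiagonal.antidiagonal r,
        Sym.conv ((Sym.ι W ∘ₗ coeff f) ∘ₗ Sym.polyPart V (p.1 + 1)) (expansion f p.2) x := by
  have h1 : Sym.conv (Sym.ι W ∘ₗ Sym.proj W) LinearMap.id (expansion f (r + 1) x) =
      ∑ I : Composition (r + 1), algebraMap ℚ k (I.blocks.length.factorial : ℚ)⁻¹ •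
        I.blocks.length • Sym.convProd (Sym.ι W ∘ₗ coeff f) I.blocks x := by
    rw [expansion, LinearMap.sum_apply, map_sum]
    refine Finset.sum_congr rfl fun I _ => ?_
    rw [LinearMap.smul_apply, map_smul, ← LinearMap.comp_apply, Sym.euler_convProd]
    rfl
  rw [h1, sum_composition_succ r fun bs => algebraMap ℚ k (bs.length.factorial : ℚ)⁻¹ •
        bs.length • Sym.convProd (Sym.ι W ∘ₗ coeff f) bs x]
  refine Finset.sum_congr rfl fun p _ => ?_
  rw [expansion, Sym.conv_sum_right, LinearMap.sum_apply]
  refine Finset.sum_congr rfl fun I _ => ?_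
  rw [List.length_cons, length_smul_inv_factorial, conv_smul_right, Sym.convProd]
  rfl

theorem toLin_polyPart (f : V ⟶ W) (r : ℕ) (x : Sym V) :
    FormalMap.toLin f (Sym.polyPart V r x) = expansion f r (Sym.polyPart V r x) := by
  induction r using Nat.strong_induction_on generalizing x with
  | _ r ih =>
  rcases r with _ | r
  · rw [Sym.polyPart_zero, map_smul, map_smul, FormalMap.map_one, expansion,
      LinearMap.sum_apply]
    congr 1
    refine Eq.trans ?_ (sum_composition_zero fun bs => (algebraMap ℚ k
      (bs.length.factorial : ℚ)⁻¹ • Sym.convProd (Sym.ι W ∘ₗ coeff f) bs) 1).symm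
    simp [Sym.convProd]
  · rw [← sub_eq_zero]
    -- A formal map has no constant term, so no block is empty and the recursion only refers to
    -- smaller degrees.
    have hφ : (Sym.ι W ∘ₗ coeff f) ∘ₗ Sym.polyPart V 0 = 0 := by
      ext y
      simp [Sym.polyPart_zero, coeff_one]
    apply Sym.eq_zero_of_euler
    · rw [map_sub, euler_toLin, euler_expansion,
        Sym.conv_polyPart, Finset.Nat.sum_antidiagonal_succ, hφ, Sym.conv_zero_left,
        LinearMap.zero_apply, zero_add, sub_eq_zero]
      refine Finset.sum_congr rfl fun p hp => ?_
      have hp' := Finset.HasAntidiagonal.mem_antidiagonal.mp hp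
      have h1 : FormalMap.toLin f ∘ₗ Sym.polyPart V p.2 =
          expansion f p.2 ∘ₗ Sym.polyPart V p.2 := LinearMap.ext (ih p.2 (by omega))
      -- The argument has polynomial degree `r + 1`; a first block of size `p.1 + 1` selects a
      -- single bidegree of its coproduct.
      rw [Sym.conv_polyPart, Finset.sum_eq_single (p.1 + 1, p.2)]
      · have h2 : ((Sym.ι W ∘ₗ coeff f) ∘ₗ Sym.polyPart V (p.1 + 1)) ∘ₗ
            Sym.polyPart V (p.1 + 1) = (Sym.ι W ∘ₗ coeff f) ∘ₗ Sym.polyPart V (p.1 + 1) := by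
          apply LinearMap.ext
          intro y
          rw [LinearMap.comp_apply, LinearMap.comp_apply, Sym.polyPart_polyPart, if_pos rfl]
          rfl
        rw [h1]
        simp only [h2]
      · rintro ⟨i, j⟩ hq hne
        have hq' := Finset.HasAntidiagonal.mem_antidiagonal.mp hq
        have h2 : ((Sym.ι W ∘ₗ coeff f) ∘ₗ Sym.polyPart V (p.1 + 1)) ∘ₗ
            Sym.polyPart V i = 0 := by
          apply LinearMap.ext
          intro y
          rw [LinearMap.comp_apply, LinearMap.comp_apply, Sym.polyPart_polyPart, if_neg,
            map_zero, LinearMap.zero_apply]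
          rintro rfl
          apply hne
          simp only at hq'
          rw [Prod.mk.injEq]
          exact ⟨rfl, by omega⟩
        simp only [h2]
        rw [Sym.conv_zero_left, LinearMap.zero_apply]
      · intro h
        exact absurd (Finset.HasAntidiagonal.mem_antidiagonal.mpr (by simp only; omega)) h
    · rw [map_sub, FormalMap.counit_comp]
      have h1 : Sym.counit V (Sym.polyPart V (r + 1) x) = 0 := by
        have h2 := Sym.polyPart_zero (Sym.polyPart V (r + 1) x)
        rw [Sym.polyPart_polyPart, if_neg (by omega)] at h2
        have h3 := congrArg (Sym.counit V) h2
        simpa using h3.symm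
      rw [h1, zero_sub, neg_eq_zero, expansion, LinearMap.sum_apply, map_sum,
        Finset.sum_eq_zero]
      intro I _
      rcases hI : I.blocks with _ | ⟨i, bs⟩
      · have := I.blocks_sum
        rw [hI] at this
        simp at this
      · rw [LinearMap.smul_apply, map_smul, Sym.counit_convProd, smul_zero]

/-- The sum over permutations is `I!` times a convolution product, by `Sym.symSum_blockProd`, so of
the normalisation `1/(I! t!)` only `1/t!` survives. -/
theorem multiCoeff_eq (f : V ⟶ W) {r : ℕ} (I : Composition r) (d : Fin r → ℤ)
    (b : ∀ i, V.obj (d i)) :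
    multiCoeff f I d b = algebraMap ℚ k (I.length.factorial : ℚ)⁻¹ •
      Sym.convProd (Sym.ι W ∘ₗ coeff f) I.blocks
        (List.ofFn fun i => Sym.gen V (d i) (b i)).prod := by
  let x : Fin r → Σ i, V.obj i := fun i => ⟨d i, b i⟩
  have hx : (List.ofFn fun i => Sym.gen V (d i) (b i)).prod = Sym.mon (List.ofFn x) := by
    rw [Sym.mon, List.map_ofFn]
    rfl
  have h1 : ∀ σ : Equiv.Perm (Fin r), (List.ofFn fun j : Fin I.length =>
        Sym.ι W (coeff f (List.ofFn fun a : Fin (I.blocksFun j) =>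
          Sym.gen V (d (σ (I.embedding j a))) (b (σ (I.embedding j a)))).prod)).prod =
      Sym.blockProd (Sym.ι W ∘ₗ coeff f) I.blocks (List.ofFn (x ∘ σ)) := by
    intro σ
    have h2 := ofFn_splitWrtComposition I (x ∘ σ)
    rw [List.splitWrtComposition] at h2
    rw [Sym.blockProd_eq, h2, List.map_ofFn]
    congr 2
    funext j
    rw [Function.comp_apply, Sym.mon, List.map_ofFn]
    rfl
  have h3 : (∏ j, (I.blocksFun j).factorial) = (I.blocks.map Nat.factorial).prod := by
    rw [← I.ofFn_blocksFun, List.map_ofFn, List.prod_ofFn]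
    rfl
  have h4 := Sym.symSum_blockProd (Sym.ι W ∘ₗ coeff f) I.blocks I.blocks_sum.symm x
  rw [multiCoeff, hx, h3]
  simp only [h1]
  rw [Sym.symSum] at h4
  rw [h4, ← Nat.cast_smul_eq_nsmul k, smul_smul, ← map_natCast (algebraMap ℚ k), ← map_mul]
  congr 2
  have h5 : ((I.blocks.map Nat.factorial).prod : ℚ) ≠ 0 := by
    rw [← h3]
    exact_mod_cast Finset.prod_ne_zero_iff.mpr fun j _ => Nat.factorial_ne_zero _
  have h6 : (I.length.factorial : ℚ) ≠ 0 := Nat.cast_ne_zero.mpr (Nat.factorial_ne_zero _)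
  rw [Nat.cast_mul]
  field_simp

/-- A formal map is the sum of its components `f_I`. -/
theorem sum_multiCoeff (f : V ⟶ W) {r : ℕ} (d : Fin r → ℤ) (b : ∀ i, V.obj (d i)) :
    ∑ I : Composition r, multiCoeff f I d b =
      FormalMap.toLin f (List.ofFn fun i => Sym.gen V (d i) (b i)).prod := by
  have hx : (List.ofFn fun i => Sym.gen V (d i) (b i)).prod =
      Sym.mon (List.ofFn fun i => (⟨d i, b i⟩ : Σ i, V.obj i)) := by
    rw [Sym.mon, List.map_ofFn]
    rfl
  have h := toLin_polyPart f r (Sym.mon (List.ofFn fun i => (⟨d i, b i⟩ : Σ i, V.obj i)))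
  rw [Sym.polyPart_mon, if_pos (List.length_ofFn), ← hx, expansion, LinearMap.sum_apply] at h
  rw [h]
  refine Finset.sum_congr rfl fun I _ => ?_
  rw [multiCoeff_eq, LinearMap.smul_apply]

end Expansion

/-! ### Vectorfields -/

section VectorField

variable {V W A B : FormalSupermanifold.{u, v} k}

theorem IsVectorField.zero : IsVectorField V 0 where
  map_degree _ _ _ := zero_mem _
  comul_comp x := by
    rw [TensorProduct.map_zero_left, TensorProduct.map_zero_right]
    simp

theorem IsVectorField.add {Q Q' : Sym V →ₗ[k] Sym V} (hQ : IsVectorField V Q)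
    (hQ' : IsVectorField V Q') : IsVectorField V (Q + Q') where
  map_degree d x hx := add_mem (hQ.map_degree d x hx) (hQ'.map_degree d x hx)
  comul_comp x := by
    rw [LinearMap.add_apply, map_add, hQ.comul_comp, hQ'.comul_comp, TensorProduct.map_add_left,
      TensorProduct.map_add_right, LinearMap.add_apply, LinearMap.add_apply]
    abel

/-- The failure of equivariance is skew relative to `F` and `F ∘ sign`: a map of degree `0` commutes
with `sign`, so the two coderivation rules match. -/
theorem comul_commutator {Q : Sym V →ₗ[k] Sym V} {Q' : Sym W →ₗ[k] Sym W}
    (hQ : IsVectorField V Q) (hQ' : IsVectorField W Q') (F : V ⟶ W) (x : Sym V) :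
    Sym.comul W ((FormalMap.toLin F ∘ₗ Q - Q' ∘ₗ FormalMap.toLin F) x) =
      TensorProduct.map (FormalMap.toLin F ∘ₗ Q - Q' ∘ₗ FormalMap.toLin F)
        (FormalMap.toLin F) (Sym.comul V x) +
      TensorProduct.map (FormalMap.toLin F ∘ₗ (Sym.sign V).toLinearMap)
        (FormalMap.toLin F ∘ₗ Q - Q' ∘ₗ FormalMap.toLin F) (Sym.comul V x) := by
  have hs : (Sym.sign W).toLinearMap ∘ₗ FormalMap.toLin F =
      FormalMap.toLin F ∘ₗ (Sym.sign V).toLinearMap :=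
    LinearMap.ext fun y => (toLin_sign F y).symm
  rw [LinearMap.sub_apply, map_sub, LinearMap.comp_apply, LinearMap.comp_apply,
    FormalMap.comul_comp F, hQ.comul_comp, hQ'.comul_comp, FormalMap.comul_comp F, map_add,
    TensorProduct.map_map, TensorProduct.map_map, TensorProduct.map_map, TensorProduct.map_map,
    LinearMap.comp_id, LinearMap.id_comp, hs]
  simp only [← TensorProduct.mapBilinear_apply, map_sub, LinearMap.sub_apply]
  abel

variable [Algebra ℚ k]

theorem equivariant_of_proj {Q : Sym V →ₗ[k] Sym V} {Q' : Sym W →ₗ[k] Sym W}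
    (hQ : IsVectorField V Q) (hQ' : IsVectorField W Q') (F : V ⟶ W)
    (h : ∀ x, Sym.proj W (FormalMap.toLin F (Q x)) = Sym.proj W (Q' (FormalMap.toLin F x)))
    (x : Sym V) : FormalMap.toLin F (Q x) = Q' (FormalMap.toLin F x) := by
  have h0 : FormalMap.toLin F ∘ₗ Q - Q' ∘ₗ FormalMap.toLin F = 0 := by
    apply Sym.eq_zero_of_skew _ (FormalMap.counit_comp F) _ (comul_commutator hQ hQ' F)
    · intro x
      rw [LinearMap.sub_apply, map_sub, sub_eq_zero]
      exact h x
    · rw [LinearMap.comp_apply, AlgHom.toLinearMap_apply, map_one, FormalMap.map_one]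
    · intro x
      rw [LinearMap.comp_apply, FormalMap.counit_comp]
      exact Sym.counit_map _ x
  exact sub_eq_zero.mp (LinearMap.congr_fun h0 x)

theorem equivariant_of_prod {Q : Sym V →ₗ[k] Sym V} {Q' : Sym (A.prod B) →ₗ[k] Sym (A.prod B)}
    (hQ : IsVectorField V Q) (hQ' : IsVectorField (A.prod B) Q') (F : V ⟶ A.prod B)
    (h1 : ∀ x, FormalMap.toLin (fst A B) (FormalMap.toLin F (Q x)) =
      FormalMap.toLin (fst A B) (Q' (FormalMap.toLin F x)))
    (h2 : ∀ x, Sym.proj B (FormalMap.toLin (snd A B) (FormalMap.toLin F (Q x))) =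
      Sym.proj B (FormalMap.toLin (snd A B) (Q' (FormalMap.toLin F x))))
    (x : Sym V) : FormalMap.toLin F (Q x) = Q' (FormalMap.toLin F x) := by
  apply equivariant_of_proj hQ hQ'
  intro x
  apply prod_total_ext
  · rw [← proj_fst, ← proj_fst, h1]
  · rw [← proj_snd, ← proj_snd, h2]

theorem IsVectorField.ext_proj {Q Q' : Sym V →ₗ[k] Sym V} (hQ : IsVectorField V Q)
    (hQ' : IsVectorField V Q') (h : ∀ x, Sym.proj V (Q x) = Sym.proj V (Q' x)) : Q = Q' :=
  LinearMap.ext (equivariant_of_proj hQ hQ' (𝟙 V) h)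

theorem IsVectorField.sq_zero_of_prod {Q : Sym (A.prod B) →ₗ[k] Sym (A.prod B)}
    (hQ : IsVectorField (A.prod B) Q)
    (h1 : ∀ x, FormalMap.toLin (fst A B) (Q (Q x)) = 0)
    (h2 : ∀ x, FormalMap.toLin (snd A B) (Q (Q x)) = 0) (x : Sym (A.prod B)) :
    Q (Q x) = 0 := by
  refine LinearMap.congr_fun (?_ : Q ∘ₗ Q = 0) x
  -- An odd `Q` anticommutes with `sign`, which cancels the mixed terms of `Δ Q²`; as `sign² = 1`,
  -- `Q²` is a coderivation without signs.
  have hs : Q ∘ₗ (Sym.sign (A.prod B)).toLinearMap +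
      (Sym.sign (A.prod B)).toLinearMap ∘ₗ Q = 0 := by
    apply Sym.hom_ext_degree
    intro d x hx
    rw [LinearMap.add_apply, LinearMap.comp_apply, LinearMap.comp_apply,
      AlgHom.toLinearMap_apply, AlgHom.toLinearMap_apply, Sym.sign_of_mem hx,
      Sym.sign_of_mem (hQ.map_degree d x hx), Sym.map_units_smul, uzpow_add, uzpow_one,
      mul_neg_one, Units.neg_smul, add_neg_cancel, LinearMap.zero_apply]
  have hss : (Sym.sign (A.prod B)).toLinearMap ∘ₗ (Sym.sign (A.prod B)).toLinearMap =
      LinearMap.id := by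
    apply Sym.hom_ext_degree
    intro d x hx
    rw [LinearMap.comp_apply, AlgHom.toLinearMap_apply (φ := Sym.sign (A.prod B)) x,
      Sym.sign_of_mem hx, Sym.map_units_smul, AlgHom.toLinearMap_apply, Sym.sign_of_mem hx, smul_smul,
      Int.units_mul_self, one_smul, LinearMap.id_apply]
  apply eq_zero_of_skew_prod (F := LinearMap.id) (G := LinearMap.id) rfl (fun _ => rfl)
    (fun _ => rfl) _ h1 h2
  intro x
  rw [LinearMap.comp_apply, hQ.comul_comp, hQ.comul_comp, map_add, map_add]
  simp only [TensorProduct.map_map, LinearMap.id_comp, LinearMap.comp_id, hss]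
  have h3 := LinearMap.congr_fun (TensorProduct.map_add_left
    (Q ∘ₗ (Sym.sign (A.prod B)).toLinearMap) ((Sym.sign (A.prod B)).toLinearMap ∘ₗ Q) Q)
    (Sym.comul _ x)
  rw [hs, TensorProduct.map_zero_left, LinearMap.zero_apply, LinearMap.add_apply] at h3
  rw [add_assoc, ← add_assoc (TensorProduct.map _ Q _) (TensorProduct.map _ Q _),
    ← h3, zero_add]

end VectorField

/-! ### Vectorfields on products -/

section Product

variable {A B C : FormalSupermanifold.{u, v} k}

variable (A B) in
/-- The linear inclusion `A → A × B`. -/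
noncomputable def inlTotal : A.Total →ₗ[k] (A.prod B).Total :=
  DirectSum.lmap fun i => LinearMap.inl k (A.obj i) (B.obj i)

variable (A B) in
/-- The linear inclusion `B → A × B`. -/
noncomputable def inrTotal : B.Total →ₗ[k] (A.prod B).Total :=
  DirectSum.lmap fun i => LinearMap.inr k (A.obj i) (B.obj i)

theorem fstTotal_inlTotal (x : A.Total) : fstTotal A B (inlTotal A B x) = x :=
  DFinsupp.ext fun _ => rfl

theorem fstTotal_inrTotal (x : B.Total) : fstTotal A B (inrTotal A B x) = 0 :=
  DFinsupp.ext fun _ => rfl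

theorem sndTotal_inlTotal (x : A.Total) : sndTotal A B (inlTotal A B x) = 0 :=
  DFinsupp.ext fun _ => rfl

theorem sndTotal_inrTotal (x : B.Total) : sndTotal A B (inrTotal A B x) = x :=
  DFinsupp.ext fun _ => rfl

theorem lmap_prod_zero_snd (x : (C.prod B).Total) :
    DirectSum.lmap (fun i => LinearMap.prod 0 (LinearMap.snd k (C.obj i) (B.obj i))) x =
      inrTotal A B (sndTotal C B x) :=
  DFinsupp.ext fun _ => rfl

theorem inlTotal_mem_range {d : ℤ} {x : A.Total} (hx : x ∈ LinearMap.range (A.hom d)) :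
    inlTotal A B x ∈ LinearMap.range ((A.prod B).hom d) := by
  obtain ⟨a, rfl⟩ := hx
  exact ⟨(a, 0), (DirectSum.lmap_lof (fun i => LinearMap.inl k (A.obj i) (B.obj i)) d a).symm⟩

theorem inrTotal_mem_range {d : ℤ} {x : B.Total} (hx : x ∈ LinearMap.range (B.hom d)) :
    inrTotal A B x ∈ LinearMap.range ((A.prod B).hom d) := by
  obtain ⟨b, rfl⟩ := hx
  exact ⟨(0, b), (DirectSum.lmap_lof (fun i => LinearMap.inr k (A.obj i) (B.obj i)) d b).symm⟩

theorem sndTotal_mem_range {d : ℤ} {x : (A.prod B).Total}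
    (hx : x ∈ LinearMap.range ((A.prod B).hom d)) :
    sndTotal A B x ∈ LinearMap.range (B.hom d) := by
  obtain ⟨b, rfl⟩ := hx
  exact ⟨b.2, (DirectSum.lmap_lof (fun i => LinearMap.snd k (A.obj i) (B.obj i)) d b).symm⟩

theorem proj_extendLeft (Q : Sym A →ₗ[k] Sym A) (x : Sym (A.prod B)) :
    Sym.proj _ (extendLeft Q x) =
      inlTotal A B (Sym.proj A (Q (FormalMap.toLin (fst A B) x))) :=
  Sym.proj_ofCoeff _ x

theorem proj_extendRight (Q : Sym B →ₗ[k] Sym B) (x : Sym (A.prod B)) :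
    Sym.proj _ (extendRight Q x) =
      inrTotal A B (Sym.proj B (Q (FormalMap.toLin (snd A B) x))) :=
  Sym.proj_ofCoeff _ x

theorem isVectorField_extendLeft {Q : Sym A →ₗ[k] Sym A} (hQ : IsVectorField A Q) :
    IsVectorField (A.prod B) (extendLeft Q) :=
  Sym.ofCoeff_isVectorField fun d x hx => inlTotal_mem_range
    (Sym.proj_mem_range (hQ.map_degree d _ (FormalMap.map_degree (fst A B) d x hx)))

theorem isVectorField_extendRight {Q : Sym B →ₗ[k] Sym B} (hQ : IsVectorField B Q) :
    IsVectorField (A.prod B) (extendRight Q) :=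
  Sym.ofCoeff_isVectorField fun d x hx => inrTotal_mem_range
    (Sym.proj_mem_range (hQ.map_degree d _ (FormalMap.map_degree (snd A B) d x hx)))

/-- The formal map `f × Id`. -/
noncomputable def prodId (B : FormalSupermanifold.{u, v} k) (f : A ⟶ C) :
    A.prod B ⟶ C.prod B :=
  prodLift (fst A B ≫ f) (snd A B)

theorem prodId_fst (f : A ⟶ C) : prodId B f ≫ fst C B = fst A B ≫ f := prodLift_fst _ _

theorem prodId_snd (f : A ⟶ C) : prodId B f ≫ snd C B = snd A B := prodLift_snd _ _

/-- The vectorfield on `A × B` pulled back from the vectorfield `Q'` on `C × B` along `f`. -/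
noncomputable def pullback (f : A ⟶ C) (Q' : Sym (C.prod B) →ₗ[k] Sym (C.prod B)) :
    Sym (A.prod B) →ₗ[k] Sym (A.prod B) :=
  ofCoeff (inrTotal A B ∘ₗ sndTotal C B ∘ₗ Sym.proj (C.prod B) ∘ₗ Q' ∘ₗ
    FormalMap.toLin (prodId B f))

theorem proj_pullback (f : A ⟶ C) (Q' : Sym (C.prod B) →ₗ[k] Sym (C.prod B))
    (x : Sym (A.prod B)) :
    Sym.proj _ (pullback f Q' x) =
      inrTotal A B (sndTotal C B (Sym.proj _ (Q' (FormalMap.toLin (prodId B f) x)))) :=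
  Sym.proj_ofCoeff _ x

theorem isVectorField_pullback (f : A ⟶ C) {Q' : Sym (C.prod B) →ₗ[k] Sym (C.prod B)}
    (hQ' : IsVectorField (C.prod B) Q') : IsVectorField (A.prod B) (pullback f Q') :=
  Sym.ofCoeff_isVectorField fun d x hx => inrTotal_mem_range (sndTotal_mem_range
    (Sym.proj_mem_range (hQ'.map_degree d _ (FormalMap.map_degree (prodId B f) d x hx))))

theorem inl_ofFn {r : ℕ} (d : Fin r → ℤ) (a : ∀ i, A.obj (d i)) :
    FormalMap.toLin (inl A B) (List.ofFn fun i => Sym.gen A (d i) (a i)).prod =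
      (List.ofFn fun i => Sym.gen (A.prod B) (d i) (a i, 0)).prod := by
  induction r with
  | zero => exact FormalMap.map_one (inl A B)
  | succ r ih =>
    rw [List.ofFn_succ, List.ofFn_succ, List.prod_cons, List.prod_cons, inl_gen_mul]
    exact congrArg _ (ih (fun i => d i.succ) fun i => a i.succ)

theorem inr_ofFn {r : ℕ} (d : Fin r → ℤ) (b : ∀ i, B.obj (d i)) :
    FormalMap.toLin (inr A B) (List.ofFn fun i => Sym.gen B (d i) (b i)).prod =
      (List.ofFn fun i => Sym.gen (A.prod B) (d i) (0, b i)).prod := by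
  induction r with
  | zero => exact FormalMap.map_one (inr A B)
  | succ r ih =>
    rw [List.ofFn_succ, List.ofFn_succ, List.prod_cons, List.prod_cons, inr_gen_mul]
    exact congrArg _ (ih (fun i => d i.succ) fun i => b i.succ)

theorem mon_eq_ofFn {V : FormalSupermanifold.{u, v} k} (l : List (Σ i, V.obj i)) :
    Sym.mon l = (List.ofFn fun i => Sym.gen V (l.get i).1 (l.get i).2).prod := by
  conv_lhs => rw [← List.ofFn_get l]
  rw [Sym.mon, List.map_ofFn]
  rfl

theorem inr_prodId (f : A ⟶ C) (y : Sym B) :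
    FormalMap.toLin (prodId B f) (FormalMap.toLin (inr A B) y) =
      FormalMap.toLin (inr C B) y := by
  have h := prodLift_inl_mul_inr f (1 : Sym A) y
  rwa [FormalMap.map_one, FormalMap.map_one, FormalMap.map_one, one_mul, one_mul] at h

variable [Algebra ℚ k]

/-- Since `f × Id` is the identity on `{0} × B`, the coefficients vanish there. The inclusion then
relates the zero field to the pullback, which upgrades this to vanishing of the whole field. -/
theorem pullback_inr (f : A ⟶ C) {Q' : Sym (C.prod B) →ₗ[k] Sym (C.prod B)}
    (hQ' : IsVectorField (C.prod B) Q')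
    (h : ∀ y, Q' (FormalMap.toLin (inr C B) y) = 0) (y : Sym B) :
    pullback f Q' (FormalMap.toLin (inr A B) y) = 0 := by
  have h' := equivariant_of_proj (Q := 0) IsVectorField.zero (isVectorField_pullback f hQ')
    (inr A B) (by
      intro x
      rw [proj_pullback, inr_prodId, h, LinearMap.zero_apply]
      simp only [map_zero]) y
  rw [← h', LinearMap.zero_apply, map_zero]

/-- On a product of base and fibre monomials `f × Id` acts as `f` on the first factor only, and `f`
there is the sum of its components `f_I`. -/
theorem isPulledBack_pullback (f : A ⟶ C) {Q' : Sym (C.prod B) →ₗ[k] Sym (C.prod B)}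
    (hQ' : IsVectorField (C.prod B) Q')
    (h : ∀ y, Q' (FormalMap.toLin (inr C B) y) = 0) : IsPulledBack f Q' (pullback f Q') where
  coeff_base r s _ d b e m := by
    refine Eq.trans ?_ (lmap_prod_zero_snd (A := A) _).symm
    rw [← inl_ofFn d b, ← inr_ofFn e m, ← inr_ofFn e m, proj_pullback, prodId,
      prodLift_inl_mul_inr, ← sum_multiCoeff, map_sum, Finset.sum_mul, map_sum, map_sum]
    rfl
  coeff_fibre s e m := by
    rw [← inr_ofFn, pullback_inr f hQ' h, map_zero]

/-- Products of base and fibre monomials span, so the two families of prescribed values fix all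
Taylor coefficients. -/
theorem IsPulledBack.unique {f : A ⟶ C} {Q' : Sym (C.prod B) →ₗ[k] Sym (C.prod B)}
    {Q₁ Q₂ : Sym (A.prod B) →ₗ[k] Sym (A.prod B)} (h₁ : IsVectorField (A.prod B) Q₁)
    (h₂ : IsVectorField (A.prod B) Q₂) (hp₁ : IsPulledBack f Q' Q₁)
    (hp₂ : IsPulledBack f Q' Q₂) : Q₁ = Q₂ := by
  apply h₁.ext_proj h₂
  refine LinearMap.congr_fun (?_ : Sym.proj _ ∘ₗ Q₁ = Sym.proj _ ∘ₗ Q₂)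
  apply hom_ext_inl_mul_inr
  intro l l'
  rw [mon_eq_ofFn l, mon_eq_ofFn l', inl_ofFn, inr_ofFn, LinearMap.comp_apply,
    LinearMap.comp_apply]
  rcases Nat.eq_zero_or_pos l.length with h0 | h0
  · obtain rfl := List.length_eq_zero_iff.mp h0
    have h := (hp₁.coeff_fibre _ (fun j => (l'.get j).1) fun j => (l'.get j).2).trans
      (hp₂.coeff_fibre _ (fun j => (l'.get j).1) fun j => (l'.get j).2).symm
    simpa using h
  · rw [hp₁.coeff_base _ _ h0, hp₂.coeff_base _ _ h0]

end Product

/-! ### The base change of a deformation -/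

section BaseChange

variable {M B B' : DGManifold.{u, v} k}

theorem proj_totalField (Q : Sym (B.carrier.prod M.carrier) →ₗ[k]
      Sym (B.carrier.prod M.carrier)) (x : Sym (B.carrier.prod M.carrier)) :
    Sym.proj _ (totalField M B Q x) =
      inrTotal _ _ (Sym.proj _ (M.Q (FormalMap.toLin (snd _ _) x))) +
        inlTotal _ _ (Sym.proj _ (B.Q (FormalMap.toLin (fst _ _) x))) + Sym.proj _ (Q x) := by
  rw [totalField, LinearMap.add_apply, LinearMap.add_apply, map_add, map_add, proj_extendLeft,
    proj_extendRight]

theorem isVectorField_totalField {Q : Sym (B.carrier.prod M.carrier) →ₗ[k]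
      Sym (B.carrier.prod M.carrier)} (hQ : IsVectorField _ Q) :
    IsVectorField _ (totalField M B Q) :=
  ((isVectorField_extendRight M.isDG.toIsVectorField).add
    (isVectorField_extendLeft B.isDG.toIsVectorField)).add hQ

theorem dgHom_ext {X Y : DGManifold.{u, v} k} {f g : X ⟶ Y} (h : underlying f = underlying g) :
    f = g :=
  DGMap.ext h

variable [Algebra ℚ k]

theorem fst_totalField_pullback (D' : Deformation M B') (f : B ⟶ B')
    (x : Sym (B.carrier.prod M.carrier)) :
    FormalMap.toLin (fst B.carrier M.carrier)
      (totalField M B (pullback (underlying f) D'.Q) x) =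
      B.Q (FormalMap.toLin (fst B.carrier M.carrier) x) := by
  apply equivariant_of_proj (isVectorField_totalField
    (isVectorField_pullback _ D'.isVectorField)) B.isDG.toIsVectorField
  intro x
  rw [proj_fst, proj_totalField, proj_pullback, map_add, map_add, fstTotal_inrTotal,
    fstTotal_inrTotal, fstTotal_inlTotal, zero_add, add_zero]

/-- Along `B'` this is the equivariance of `f` combined with that of both projections; along `M` the
coefficients agree by the definition of `pullback`. -/
theorem prodId_totalField_pullback (D' : Deformation M B') (f : B ⟶ B')
    (x : Sym (B.carrier.prod M.carrier)) :
    FormalMap.toLin (prodId M.carrier (underlying f))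
      (totalField M B (pullback (underlying f) D'.Q) x) =
      totalField M B' D'.Q (FormalMap.toLin (prodId M.carrier (underlying f)) x) := by
  have h1 : ∀ y, FormalMap.toLin (fst B'.carrier M.carrier)
      (FormalMap.toLin (prodId M.carrier (underlying f)) y) =
      FormalMap.toLin (underlying f) (FormalMap.toLin (fst B.carrier M.carrier) y) := by
    intro y
    rw [← toLin_comp, prodId_fst, toLin_comp]
  have h2 : ∀ y, FormalMap.toLin (snd B'.carrier M.carrier)
      (FormalMap.toLin (prodId M.carrier (underlying f)) y) =
      FormalMap.toLin (snd B.carrier M.carrier) y := by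
    intro y
    rw [← toLin_comp, prodId_snd]
  apply equivariant_of_prod (isVectorField_totalField
    (isVectorField_pullback _ D'.isVectorField)) (isVectorField_totalField D'.isVectorField)
  · intro x
    rw [h1, fst_totalField_pullback, D'.proj_equivariant, h1]
    exact DGMap.equivariant f _
  · intro x
    rw [h2, proj_snd, proj_snd, proj_totalField, proj_totalField, proj_pullback, h2]
    simp only [map_add, sndTotal_inrTotal, sndTotal_inlTotal]

/-- The base change of a deformation along a morphism of formal DG manifolds. -/
noncomputable def Deformation.baseChange (D' : Deformation M B') (hB : B.IsLocal)
    (f : B ⟶ B') : Deformation M B where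
  isLocal := hB
  Q := pullback (underlying f) D'.Q
  isVectorField := isVectorField_pullback _ D'.isVectorField
  Q_zero := by
    rw [← FormalMap.map_one (inr B.carrier M.carrier)]
    exact pullback_inr _ D'.isVectorField D'.restrict 1
  restrict := pullback_inr _ D'.isVectorField D'.restrict
  isDG :=
    { toIsVectorField := isVectorField_totalField (isVectorField_pullback _ D'.isVectorField)
      sq_zero := by
        apply IsVectorField.sq_zero_of_prod
          (isVectorField_totalField (isVectorField_pullback _ D'.isVectorField))
        · intro x
          rw [fst_totalField_pullback, fst_totalField_pullback, B.isDG.sq_zero]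
        · intro x
          -- The projection to `M` factors through `f × Id`, which carries the square of the total
          -- field to the one on `B' × M`, known to vanish.
          rw [← prodId_snd (underlying f), toLin_comp, prodId_totalField_pullback,
            prodId_totalField_pullback, D'.isDG.sq_zero, map_zero] }
  proj_equivariant := fst_totalField_pullback D' f

/-- The morphism `f × Id` from the total space of the base change. -/
noncomputable def Deformation.baseChangeMap (D' : Deformation M B') (hB : B.IsLocal)
    (f : B ⟶ B') : (D'.baseChange hB f).total ⟶ D'.total :=
  (⟨prodId M.carrier (underlying f), prodId_totalField_pullback D' f⟩ :
    DGMap (D'.baseChange hB f).total D'.total)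

theorem prodLift_prodId {X A B C : FormalSupermanifold.{u, v} k} {f : A ⟶ C} {a : X ⟶ C.prod B}
    {b : X ⟶ A} (h : a ≫ fst C B = b ≫ f) :
    prodLift b (a ≫ snd C B) ≫ prodId B f = a := by
  apply hom_ext_prod
  · rw [Category.assoc, prodId_fst, ← Category.assoc, prodLift_fst, h]
  · rw [Category.assoc, prodId_snd, prodLift_snd]

theorem hom_ext_prodId {X A B C : FormalSupermanifold.{u, v} k} {f : A ⟶ C}
    {g h : X ⟶ A.prod B} (h1 : g ≫ prodId B f = h ≫ prodId B f)
    (h2 : g ≫ fst A B = h ≫ fst A B) : g = h := by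
  apply hom_ext_prod h2
  rw [← prodId_snd f, ← Category.assoc, h1, Category.assoc]

theorem prodLift_equivariant (D' : Deformation M B') {f : B ⟶ B'}
    {X : FormalSupermanifold.{u, v} k} {Q : Sym X →ₗ[k] Sym X} (hQ : IsVectorField X Q)
    {a : X ⟶ B'.carrier.prod M.carrier} {b : X ⟶ B.carrier}
    (h : a ≫ fst _ _ = b ≫ underlying f)
    (ha : ∀ x, FormalMap.toLin a (Q x) = totalField M B' D'.Q (FormalMap.toLin a x))
    (hb : ∀ x, FormalMap.toLin b (Q x) = B.Q (FormalMap.toLin b x)) (x : Sym X) :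
    FormalMap.toLin (prodLift b (a ≫ snd _ _)) (Q x) =
      totalField M B (pullback (underlying f) D'.Q)
        (FormalMap.toLin (prodLift b (a ≫ snd _ _)) x) := by
  apply equivariant_of_prod hQ
    (isVectorField_totalField (isVectorField_pullback _ D'.isVectorField))
  · intro x
    rw [fst_totalField_pullback, ← toLin_comp, ← toLin_comp, prodLift_fst, hb]
  · intro x
    congr 1
    -- The `M`-component is compared on `B' × M`, where the lift followed by `f × Id` is `a` and the
    -- equivariance of `a` applies.
    rw [← toLin_comp, prodLift_snd, toLin_comp, ha, ← prodId_snd (underlying f),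
      toLin_comp (prodId M.carrier (underlying f)), prodId_totalField_pullback,
      ← toLin_comp _ (prodId M.carrier (underlying f)), prodLift_prodId h]

/-- The underlying square is cartesian because both total spaces are products with the same fibre
`M`. The graded lift is equivariant by `prodLift_equivariant`, so it is a lift of formal DG
manifolds. -/
theorem Deformation.isPullback_baseChangeMap (D' : Deformation M B') (hB : B.IsLocal)
    (f : B ⟶ B') :
    IsPullback (D'.baseChangeMap hB f) (D'.baseChange hB f).proj D'.proj f := by
  have w : D'.baseChangeMap hB f ≫ D'.proj = (D'.baseChange hB f).proj ≫ f :=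
    dgHom_ext (prodId_fst (underlying f))
  refine ⟨⟨w⟩, ⟨Limits.PullbackCone.IsLimit.mk w (fun s => (⟨_, prodLift_equivariant D'
    s.pt.isDG.toIsVectorField (congrArg underlying s.condition) (DGMap.equivariant s.fst)
    (DGMap.equivariant s.snd)⟩ : DGMap s.pt (D'.baseChange hB f).total))
    (fun s => dgHom_ext (prodLift_prodId (congrArg underlying s.condition)))
    (fun s => dgHom_ext (prodLift_fst _ _)) ?_⟩⟩
  intro s m hm1 hm2
  exact dgHom_ext (hom_ext_prodId (f := underlying f)
    ((congrArg underlying hm1).trans (prodLift_prodId (congrArg underlying s.condition)).symm)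
    ((congrArg underlying hm2).trans (prodLift_fst _ _).symm))

end BaseChange

end Basic

end FormalDG

theorem mainTheorem8 {k : Type u} [CommRing k] [Algebra ℚ k]
    (M B B' : FormalDG.DGManifold.{u, v} k) (D' : FormalDG.Deformation M B')
    (hB : B.IsLocal) (f : B ⟶ B') :
    ∃ D : FormalDG.Deformation M B,
      -- the pulled-back perturbation exists, is unique, and is a deformation
      FormalDG.IsPulledBack (FormalDG.underlying f) D'.Q D.Q ∧
      (∀ Q : FormalDG.Sym (B.carrier.prod M.carrier) →ₗ[k]
          FormalDG.Sym (B.carrier.prod M.carrier),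
        FormalDG.IsVectorField (B.carrier.prod M.carrier) Q →
        FormalDG.IsPulledBack (FormalDG.underlying f) D'.Q Q → Q = D.Q) ∧
      -- `F = f × Id` is equivariant, and `(F, f)` is a morphism of deformations
      ∃ F : D.total ⟶ D'.total,
        FormalDG.IsProdId (FormalDG.underlying f) (FormalDG.underlying F) ∧
        (∀ G : B.carrier.prod M.carrier ⟶ B'.carrier.prod M.carrier,
          FormalDG.IsProdId (FormalDG.underlying f) G → G = FormalDG.underlying F) ∧
        D.IsMorphism D' F f := by
  have hp := FormalDG.isPulledBack_pullback (FormalDG.underlying f) D'.isVectorField D'.restrict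
  refine ⟨D'.baseChange hB f, hp,
    fun Q hQ h => h.unique hQ (D'.baseChange hB f).isVectorField hp,
    D'.baseChangeMap hB f, ⟨FormalDG.prodId_fst _, FormalDG.prodId_snd _⟩, fun G hG => ?_,
    D'.isPullback_baseChangeMap hB f, ?_⟩
  · exact FormalDG.hom_ext_prod (hG.comp_fst.trans (FormalDG.prodId_fst _).symm)
      (hG.comp_snd.trans (FormalDG.prodId_snd _).symm)
  · exact FormalDG.toLin_ext fun y => FormalDG.inr_prodId _ y
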